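/- \textbf{The problem.} Let $G=(V,E)$ be a finite directed graph and let $a\in\mathbb{R}_{\ge 0}^{V}$ be a vector of target values. A vector $x\in\mathbb{R}^V$ is a \emph{valid solution} if $x_v\ge 0$ for every $v\in V$ and $\sum_{u:(u,w)\in E}x_u\le x_w$ for every $w\in V$. Its cost is $\|a-x\|_1=\sum_{v\in V}|a_v-x_v|$. The graph $G$ is \emph{bilayered} if $V$ is the disjoint union of two sets $U$ and $W$ with $E\subseteq U\times W$. \textbf{Model of computation.} Running time is the number of steps of a real RAM: a fixed finite program works on arrays of natural numbers (addition, truncated subtraction, comparison, use as addresses) and on arrays of real numbers (addition, subtraction, multiplication, division, comparison), the only constants in it are natural numbers, and each elementary operation, memory access, assignment or test counts as one step. The input consists of $|V|$ (the vertices being numbered), $|E|$, a list of the edges in any order, the vector $a$ and the number $\varepsilon$. \textbf{Theorem.} There are a real RAM program and a constant $C$ such that for every bilayered graph $G=(V,E)$, every $a\in\mathbb{R}_{\ge0}^V$ and every real $\varepsilon>0$, the program halts on this input and outputs a valid solution whose cost is at most $(1+\varepsilon)$ times the cost of every valid solution; in other words, at most $(1+\varepsilon)$ times the optimum. If $E\neq\emptyset$,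 it halts within $$C\cdot\frac{|V|\,|E|\,\log|V|}{\min(\varepsilon,1)^2}$$ steps. In particular, for $0<\varepsilon\le 1$ the running time is $O(|V||E|\log|V|/\varepsilon^2)$. -/

import Mathlib

/-! ### A real RAM

Programs are structured (`while`) programs over a store that holds finitely many relevant arrays of
natural numbers (used for counting and addressing) and finitely many relevant arrays of real
numbers; a scalar variable is a cell of an array. Natural numbers can be added, subtracted
(truncated at `0`) and compared, reals can be added, subtracted, multiplied, divided and compared.
There is no rounding and no conversion between the two sorts, and the only constants are natural
numbers. Each elementary operation, memory access, assignment and test counts one step. -/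

namespace RealRAM

/-- The memory: `s.nat k i` and `s.real k i` are the `i`-th cells of the `k`-th array of natural
numbers and of the `k`-th array of real numbers. -/
structure Store where
  nat : ℕ → ℕ → ℕ
  real : ℕ → ℕ → ℝ

/-- Expressions for natural numbers. -/
inductive NExpr where
  | const (c : ℕ)
  | get (arr : ℕ) (i : NExpr)
  | add (e f : NExpr)
  | sub (e f : NExpr)

/-- Expressions for real numbers. -/
inductive RExpr where
  | const (c : ℕ)
  | get (arr : ℕ) (i : NExpr)
  | add (e f : RExpr)
  | sub (e f : RExpr)
  | mul (e f : RExpr)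
  | div (e f : RExpr)

/-- Tests. -/
inductive Cond where
  | nle (e f : NExpr)
  | rle (e f : RExpr)
  | not (b : Cond)
  | and (b c : Cond)

/-- Programs. -/
inductive Prog where
  | skip
  | setN (arr : ℕ) (i : NExpr) (e : NExpr)
  | setR (arr : ℕ) (i : NExpr) (e : RExpr)
  | seq (p q : Prog)
  | ite (b : Cond) (p q : Prog)
  | loop (b : Cond) (p : Prog)

def NExpr.eval (s : Store) : NExpr → ℕ
  | const c => c
  | get arr i => s.nat arr (i.eval s)
  | add e f => e.eval s + f.eval s
  | sub e f => e.eval s - f.eval s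

/-- Number of steps for evaluating an expression: one per operation, constant or access. -/
def NExpr.cost : NExpr → ℕ
  | const _ => 1
  | get _ i => i.cost + 1
  | add e f => e.cost + f.cost + 1
  | sub e f => e.cost + f.cost + 1

/-- Division by zero returns zero (a program can test for zero anyway). -/
noncomputable def RExpr.eval (s : Store) : RExpr → ℝ
  | const c => c
  | get arr i => s.real arr (i.eval s)
  | add e f => e.eval s + f.eval s
  | sub e f => e.eval s - f.eval s
  | mul e f => e.eval s * f.eval s
  | div e f => e.eval s / f.eval s

def RExpr.cost : RExpr → ℕ
  | const _ => 1
  | get _ i => i.cost + 1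
  | add e f => e.cost + f.cost + 1
  | sub e f => e.cost + f.cost + 1
  | mul e f => e.cost + f.cost + 1
  | div e f => e.cost + f.cost + 1

def Cond.holds (s : Store) : Cond → Prop
  | nle e f => e.eval s ≤ f.eval s
  | rle e f => e.eval s ≤ f.eval s
  | not b => ¬ b.holds s
  | and b c => b.holds s ∧ c.holds s

def Cond.cost : Cond → ℕ
  | nle e f => e.cost + f.cost + 1
  | rle e f => e.cost + f.cost + 1
  | not b => b.cost + 1
  | and b c => b.cost + c.cost + 1

/-- The store after writing `v` into cell `i` of the natural-number array `arr`. -/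
def Store.writeN (s : Store) (arr i v : ℕ) : Store where
  nat := Function.update s.nat arr (Function.update (s.nat arr) i v)
  real := s.real

/-- The store after writing `v` into cell `i` of the real array `arr`. -/
noncomputable def Store.writeR (s : Store) (arr i : ℕ) (v : ℝ) : Store where
  nat := s.nat
  real := Function.update s.real arr (Function.update (s.real arr) i v)

/-- `Exec p s t s'`: started in the store `s`, the program `p` halts after exactly `t` steps, in
the store `s'`. The rules are deterministic: `t` and `s'` are determined by `p` and `s`. -/
inductive Exec : Prog → Store → ℕ → Store → Prop
  | skip (s : Store) : Exec Prog.skip s 1 s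
  | setN (s : Store) (arr : ℕ) (i e : NExpr) :
      Exec (Prog.setN arr i e) s (i.cost + e.cost + 1) (s.writeN arr (i.eval s) (e.eval s))
  | setR (s : Store) (arr : ℕ) (i : NExpr) (e : RExpr) :
      Exec (Prog.setR arr i e) s (i.cost + e.cost + 1) (s.writeR arr (i.eval s) (e.eval s))
  | seq {p q : Prog} {s s' s'' : Store} {t t' : ℕ} :
      Exec p s t s' → Exec q s' t' s'' → Exec (Prog.seq p q) s (t + t') s''
  | iteTrue {b : Cond} {p q : Prog} {s s' : Store} {t : ℕ} :
      b.holds s → Exec p s t s' → Exec (Prog.ite b p q) s (b.cost + 1 + t) s'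
  | iteFalse {b : Cond} {p q : Prog} {s s' : Store} {t : ℕ} :
      ¬ b.holds s → Exec q s t s' → Exec (Prog.ite b p q) s (b.cost + 1 + t) s'
  | loopDone {b : Cond} {p : Prog} {s : Store} :
      ¬ b.holds s → Exec (Prog.loop b p) s (b.cost + 1) s
  | loopStep {b : Cond} {p : Prog} {s s' s'' : Store} {t t' : ℕ} :
      b.holds s → Exec p s t s' → Exec (Prog.loop b p) s' t' s'' →
        Exec (Prog.loop b p) s (b.cost + 1 + t + t') s''

end RealRAM

/-! ### Sum-based hierarchical smoothing -/

namespace SumSmoothing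

/-- `x` is a valid assignment: it is nonnegative, and the value of each vertex is at least the sum
of the values of its children, that is, of the vertices with an edge to it. -/
def IsValid {V : Type*} [Fintype V] (G : Digraph V) [DecidableRel G.Adj] (x : V → ℝ) : Prop :=
  (∀ v, 0 ≤ x v) ∧ ∀ w, ∑ u ∈ Finset.univ.filter (fun u => G.Adj u w), x u ≤ x w

/-- The objective value `‖a - x‖₁`. -/
def l1Cost {V : Type*} [Fintype V] (a x : V → ℝ) : ℝ := ∑ v, |a v - x v|

/-- The vertices split into two parts such that every edge goes from the first to the second. -/
def IsBilayered {V : Type*} (G : Digraph V) : Prop :=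
  ∃ U W : Set V, U ∪ W = Set.univ ∧ Disjoint U W ∧ ∀ u w, G.Adj u w → u ∈ U ∧ w ∈ W

/-- `edges` lists every edge of `G` exactly once, in any order. -/
def IsEdgeList {V : Type*} (G : Digraph V) (edges : List (V × V)) : Prop :=
  edges.Nodup ∧ ∀ u w, (u, w) ∈ edges ↔ G.Adj u w

/-- The natural-number part of the input: `n` and the number of edges in cells `0` and `1` of
array `0`, the tails of the edges in array `1`, their heads in array `2`; all else is `0`. -/
def inputNat {n : ℕ} (edges : List (Fin n × Fin n)) : ℕ → ℕ → ℕ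
  | 0, 0 => n
  | 0, 1 => edges.length
  | 1, i => (edges[i]?.map fun e => (e.1 : ℕ)).getD 0
  | 2, i => (edges[i]?.map fun e => (e.2 : ℕ)).getD 0
  | _, _ => 0

/-- The real part of the input: `ε` in cell `0` of array `0`, the target values in array `1`;
all else is `0`. -/
noncomputable def inputReal {n : ℕ} (a : Fin n → ℝ) (ε : ℝ) : ℕ → ℕ → ℝ
  | 0, 0 => ε
  | 1, i => if h : i < n then a ⟨i, h⟩ else 0
  | _, _ => 0

/-- The store in which a program is started. -/
noncomputable def inputStore {n : ℕ} (edges : List (Fin n × Fin n)) (a : Fin n → ℝ) (ε : ℝ) :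
    RealRAM.Store where
  nat := inputNat edges
  real := inputReal a ε

/-- The assignment that a program leaves in cells `0, …, n - 1` of the real array `2`. -/
def output (n : ℕ) (s : RealRAM.Store) : Fin n → ℝ := fun v => s.real 2 v

end SumSmoothing

/-!
The algorithm is a multiplicative weights method for the covering formulation of the problem.

Let `V` be the vertex set. Every vertex `v` carries a length `ℓ v = (1 + e) ^ k v`, where
`e = min ε 1 / 8` and initially `k = 0`, and there is a scale `θ`. The pair stands for the
assignment `roundLen`, which raises the target value of `v` by `ℓ v / θ` if `v` has children and
otherwise lowers it by this amount (but not below `0`). Its cost is at most `(∑ v, ℓ v) / θ`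
(`l1Cost_roundLen_le`), and as no child of a vertex has children itself, it is valid as soon as at
no vertex `w` the remaining demand `∑ max 0 (θ * a u - ℓ u)` of the children `u` of `w` exceeds
`θ * a w + ℓ w` (`isValid_roundLen`).
A phase keeps `θ` fixed and, as long as some `w` is violated, multiplies by `1 + e` the lengths of
`w` and of its active children, those with `ℓ u ≤ θ * a u`. Then `θ` grows by the factor `1 + e`.
It starts at `1 / B`, where `B` is the greatest violation of a constraint by the target values
themselves (if there is none, these are the optimum).

Let `y` be a valid assignment. If `w` is violated and `T` is the set of its active children, the
sum of the target values over `T` exceeds `a w` by at most the deviation `|a - y|` on `T` and `w`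
(`sum_sub_le_deviation`). So a push increases the total length by at most `e * θ` times the increase
of the potential `∑ v, |a v - y v| * k v` (`sum_len_push_le`), while only lengths below `θ * B` are
increased, so that no exponent exceeds the number `p` of the phase (`push_le`). If all assignments
recorded so far cost more than `(1 + 8 * e)` times the cost of `y`, the total length is therefore at
most `|V| * exp (e * (1 + e) * p / (1 + 8 * e))` (`PhaseInv.step`). On the other hand, it is at
least `(1 + e) ^ p`, as the cost of `y` is at least `B`. For `p ≥ q / e` with `(1 + e) ^ q ≥ |V|`
this is a contradiction (`PhaseInv.best_le_mul`).

This needs `O(log |V| / e ^ 2)` phases. A phase examines every vertex once, apart from examinations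
followed by a push; each push increases the exponent of some vertex, so that there are at most
`|V| * p` pushes altogether. An examination scans the list of edges.
-/

/-! ### Total correctness with time bounds -/

namespace RealRAM

/-- `p` may write into the array `k` of natural numbers. -/
def Prog.writesN : Prog → ℕ → Bool
  | skip, _ => false
  | setN arr _ _, k => arr == k
  | setR _ _ _, _ => false
  | seq p q, k => p.writesN k || q.writesN k
  | ite _ p q, k => p.writesN k || q.writesN k
  | loop _ p, k => p.writesN k

/-- `p` may write into the array `k` of real numbers. -/
def Prog.writesR : Prog → ℕ → Bool
  | skip, _ => false
  | setN _ _ _, _ => false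
  | setR arr _ _, k => arr == k
  | seq p q, k => p.writesR k || q.writesR k
  | ite _ p q, k => p.writesR k || q.writesR k
  | loop _ p, k => p.writesR k

/-- The stores `s` and `s'` agree on every array that `p` does not write into. -/
structure Frame (p : Prog) (s s' : Store) : Prop where
  nat : ∀ k, p.writesN k = false → s'.nat k = s.nat k
  real : ∀ k, p.writesR k = false → s'.real k = s.real k

theorem Frame.refl (p : Prog) (s : Store) : Frame p s s := ⟨fun _ _ => rfl, fun _ _ => rfl⟩

theorem Frame.trans {p : Prog} {s s' s'' : Store} (h : Frame p s s') (h' : Frame p s' s'') :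
    Frame p s s'' :=
  ⟨fun k hk => (h'.nat k hk).trans (h.nat k hk), fun k hk => (h'.real k hk).trans (h.real k hk)⟩

theorem Frame.mono {p q : Prog} {s s' : Store} (h : Frame p s s')
    (hN : ∀ k, q.writesN k = false → p.writesN k = false)
    (hR : ∀ k, q.writesR k = false → p.writesR k = false) : Frame q s s' :=
  ⟨fun k hk => h.nat k (hN k hk), fun k hk => h.real k (hR k hk)⟩

theorem Exec.frame {p : Prog} {s s' : Store} {t : ℕ} (h : Exec p s t s') : Frame p s s' := by
  induction h with
  | skip s => exact Frame.refl _ _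
  | setN s arr i e =>
    refine ⟨fun k hk => ?_, fun k _ => rfl⟩
    have : k ≠ arr := by rintro rfl; simp [Prog.writesN] at hk
    simp [Store.writeN, this]
  | setR s arr i e =>
    refine ⟨fun k _ => rfl, fun k hk => ?_⟩
    have : k ≠ arr := by rintro rfl; simp [Prog.writesR] at hk
    simp [Store.writeR, this]
  | seq _ _ h1 h2 =>
    refine (h1.mono ?_ ?_).trans (h2.mono ?_ ?_) <;>
      (intro k hk; simp_all [Prog.writesN, Prog.writesR])
  | iteTrue _ _ h1 =>
    refine h1.mono ?_ ?_ <;> (intro k hk; simp_all [Prog.writesN, Prog.writesR])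
  | iteFalse _ _ h1 =>
    refine h1.mono ?_ ?_ <;> (intro k hk; simp_all [Prog.writesN, Prog.writesR])
  | loopDone _ => exact Frame.refl _ _
  | loopStep _ _ _ h1 h2 =>
    exact Frame.trans (h1.mono (fun _ hk => hk) (fun _ hk => hk)) h2

/-- Started in `s`, the program `p` halts within `T` steps in a store that satisfies `Q`. -/
def Run (p : Prog) (s : Store) (T : ℕ) (Q : Store → Prop) : Prop :=
  ∃ t s', Exec p s t s' ∧ t ≤ T ∧ Q s'

theorem Run.mono {p : Prog} {s : Store} {T T' : ℕ} {Q Q' : Store → Prop} (h : Run p s T Q)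
    (hT : T ≤ T') (hQ : ∀ s', Frame p s s' → Q s' → Q' s') : Run p s T' Q' := by
  obtain ⟨t, s', he, ht, hq⟩ := h
  exact ⟨t, s', he, ht.trans hT, hQ s' he.frame hq⟩

theorem Run.skip {s : Store} {Q : Store → Prop} (h : Q s) : Run .skip s 1 Q :=
  ⟨1, s, .skip s, le_rfl, h⟩

theorem Run.setN {s : Store} {arr : ℕ} {i e : NExpr} {Q : Store → Prop}
    (h : Q (s.writeN arr (i.eval s) (e.eval s))) :
    Run (.setN arr i e) s (i.cost + e.cost + 1) Q :=
  ⟨_, _, .setN s arr i e, le_rfl, h⟩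

theorem Run.setR {s : Store} {arr : ℕ} {i : NExpr} {e : RExpr} {Q : Store → Prop}
    (h : Q (s.writeR arr (i.eval s) (e.eval s))) :
    Run (.setR arr i e) s (i.cost + e.cost + 1) Q :=
  ⟨_, _, .setR s arr i e, le_rfl, h⟩

theorem Run.seq {p q : Prog} {s : Store} {T T' : ℕ} {Q : Store → Prop}
    (h : Run p s T (fun s' => Run q s' T' Q)) : Run (.seq p q) s (T + T') Q := by
  obtain ⟨t, s', he, ht, t', s'', he', ht', hq⟩ := h
  exact ⟨_, _, .seq he he', add_le_add ht ht', hq⟩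

theorem Run.ite {b : Cond} {p q : Prog} {s : Store} {T : ℕ} {Q : Store → Prop}
    (h1 : b.holds s → Run p s T Q) (h2 : ¬ b.holds s → Run q s T Q) :
    Run (.ite b p q) s (b.cost + 1 + T) Q := by
  by_cases hb : b.holds s
  · obtain ⟨t, s', he, ht, hq⟩ := h1 hb
    exact ⟨_, _, .iteTrue hb he, by omega, hq⟩
  · obtain ⟨t, s', he, ht, hq⟩ := h2 hb
    exact ⟨_, _, .iteFalse hb he, by omega, hq⟩

theorem Run.loopDone {b : Cond} {p : Prog} {s : Store} {Q : Store → Prop} (hb : ¬ b.holds s)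
    (h : Q s) : Run (.loop b p) s (b.cost + 1) Q :=
  ⟨_, _, .loopDone hb, le_rfl, h⟩

theorem Run.loopStep {b : Cond} {p : Prog} {s : Store} {T T' : ℕ} {Q : Store → Prop}
    (hb : b.holds s) (h : Run p s T (fun s' => Run (.loop b p) s' T' Q)) :
    Run (.loop b p) s (b.cost + 1 + T + T') Q := by
  obtain ⟨t, s', he, ht, t', s'', he', ht', hq⟩ := h
  exact ⟨_, _, .loopStep hb he he', by omega, hq⟩

/-- A scalar variable of natural type: cell `0` of an array. -/
abbrev NExpr.var (k : ℕ) : NExpr := .get k (.const 0)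

/-- A scalar variable of real type: cell `0` of an array. -/
abbrev RExpr.var (k : ℕ) : RExpr := .get k (.const 0)

/-- Assignment to a scalar variable of natural type. -/
abbrev Prog.letN (k : ℕ) (e : NExpr) : Prog := .setN k (.const 0) e

/-- Assignment to a scalar variable of real type. -/
abbrev Prog.letR (k : ℕ) (e : RExpr) : Prog := .setR k (.const 0) e

/-- The loop "for `v = 0, …, N - 1` do `body`", where `N` is in cell `b` of the array `0`. -/
def Prog.forRange (v b : ℕ) (body : Prog) : Prog :=
  .seq (.letN v (.const 0))
    (.loop (.not (.nle (.get 0 (.const b)) (.var v)))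
      (.seq body (.letN v (.add (.var v) (.const 1)))))

/-- The invariant rule for counting loops. In the body one may use that arrays which the loop does
not write into are as they were at its start. -/
theorem Run.forRange {v b : ℕ} {body : Prog} {s : Store} {c : ℕ} (I : ℕ → Store → Prop)
    (hv : v ≠ 0) (hv' : body.writesN v = false) (h0 : body.writesN 0 = false)
    (hI : ∀ i s x, I i s → I i (s.writeN v 0 x)) (hs : I 0 s)
    (hbody : ∀ i s', i < s.nat 0 b → Frame (.forRange v b body) s s' → s'.nat v 0 = i → I i s' →
      Run body s' c (I (i + 1))) :
    Run (.forRange v b body) s (s.nat 0 b * (c + 13) + 10) (I (s.nat 0 b)) := by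
  have key : ∀ j i s', i + j = s.nat 0 b → Frame (.forRange v b body) s s' → s'.nat v 0 = i →
      I i s' → Run (.loop (.not (.nle (.get 0 (.const b)) (.var v)))
        (.seq body (.letN v (.add (.var v) (.const 1))))) s' (j * (c + 13) + 7) (I (s.nat 0 b)) := by
    have hw0 : (Prog.forRange v b body).writesN 0 = false := by
      simp [Prog.forRange, Prog.writesN, h0, hv]
    intro j
    induction j with
    | zero =>
      intro i s' hij hF hvi hIi
      refine (Run.loopDone ?_ ?_).mono (Q := I (s.nat 0 b)) ?_ (fun _ _ h => h)
      · have := hF.nat 0 hw0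
        simp [Cond.holds, NExpr.eval, hvi, this]; omega
      · have : i = s.nat 0 b := by omega
        exact this ▸ hIi
      · simp [Cond.cost, NExpr.cost]
    | succ j ih =>
      intro i s' hij hF hvi hIi
      have hb := hF.nat 0 hw0
      refine Run.mono (T := 7 + (c + 6) + (j * (c + 13) + 7)) (Q := I (s.nat 0 b)) ?_
        (by ring_nf; omega) (fun _ _ h => h)
      refine Run.loopStep (T := c + 6) ?_ (Run.seq (T' := 6) ?_)
      · simp [Cond.holds, NExpr.eval, hvi, hb]; omega
      · refine (hbody i s' (by omega) hF hvi hIi).mono le_rfl fun s1 hF1 hI1 => ?_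
        refine (Run.setN ?_).mono (Q := fun s' => Run _ s' _ (I (s.nat 0 b)))
          (by simp [NExpr.cost]) (fun _ _ h => h)
        have hv1 : s1.nat v 0 = i := by rw [hF1.nat v hv', hvi]
        simp only [NExpr.eval, hv1]
        refine ih (i + 1) _ (by omega) ?_ ?_ (hI _ _ _ hI1)
        · refine hF.trans ⟨fun k hk => ?_, fun k hk => ?_⟩
          · have hk' : k ≠ v ∧ body.writesN k = false := by
              simp [Prog.forRange, Prog.writesN] at hk
              exact ⟨fun h => hk.1 h.symm, hk.2.1⟩
            simp [Store.writeN, hk'.1, hF1.nat k hk'.2]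
          · have hk' : body.writesR k = false := by
              simpa [Prog.forRange, Prog.writesR] using hk
            simp [Store.writeN, hF1.real k hk']
        · simp [Store.writeN]
  refine Run.mono (T := 3 + (s.nat 0 b * (c + 13) + 7)) (Q := I (s.nat 0 b)) ?_ (by omega)
    (fun _ _ h => h)
  refine Run.seq ((Run.setN ?_).mono (Q := fun s' => Run _ s' _ (I (s.nat 0 b)))
    (by simp [NExpr.cost]) (fun _ _ h => h))
  refine key _ 0 _ (by omega) ?_ (by simp [Store.writeN, NExpr.eval]) (hI _ _ _ hs)
  refine ⟨fun k hk => ?_, fun k hk => rfl⟩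
  have hk' : k ≠ v := by
    simp [Prog.forRange, Prog.writesN] at hk
    exact fun h => hk.1 h.symm
  simp [Store.writeN, hk']

end RealRAM

/-! ### Multiplicative weights for smoothing -/

namespace SumSmoothing

open Finset

set_option linter.unusedSectionVars false

section Weights

variable {V : Type*} [Fintype V] [DecidableEq V] (G : Digraph V) [DecidableRel G.Adj] (a : V → ℝ)

/-- The amount by which the target values violate the constraint at `w`. -/
def excess (w : V) : ℝ := ∑ u ∈ univ.filter (fun u => G.Adj u w), a u - a w

/-- The children `u` of `w` with `ℓ u ≤ θ * a u`. -/
noncomputable def active (θ : ℝ) (ℓ : V → ℝ) (w : V) : Finset V :=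
  univ.filter fun u => G.Adj u w ∧ ℓ u ≤ θ * a u

/-- The demand at `w` in the assignment `u ↦ max 0 (a u - ℓ u / θ)`, scaled by `θ`. -/
noncomputable def demand (θ : ℝ) (ℓ : V → ℝ) (w : V) : ℝ :=
  ∑ u ∈ active G a θ ℓ w, (θ * a u - ℓ u)

/-- The lengths `(1 + e) ^ k` given by exponents `k`. -/
noncomputable def len (e : ℝ) (k : V → ℕ) (v : V) : ℝ := (1 + e) ^ k v

/-- The exponents after multiplying the lengths of `w` and of its active children by `1 + e`. -/
noncomputable def push (θ e : ℝ) (k : V → ℕ) (w : V) (v : V) : ℕ :=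
  k v + if v ∈ insert w (active G a θ (len e k) w) then 1 else 0

variable {G a}

theorem demand_eq_sum_max (θ : ℝ) (ℓ : V → ℝ) (w : V) :
    demand G a θ ℓ w = ∑ u ∈ univ.filter (fun u => G.Adj u w), max 0 (θ * a u - ℓ u) := by
  rw [demand, active, ← filter_filter, sum_filter]
  refine sum_congr rfl fun u _ => ?_
  split_ifs with h
  · rw [max_eq_right (by linarith)]
  · rw [max_eq_left (by linarith)]

theorem demand_antitone (θ : ℝ) {ℓ ℓ' : V → ℝ} (h : ∀ v, ℓ v ≤ ℓ' v) (w : V) :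
    demand G a θ ℓ' w ≤ demand G a θ ℓ w := by
  rw [demand_eq_sum_max, demand_eq_sum_max]
  exact sum_le_sum fun u _ => max_le_max le_rfl (by linarith [h u])

/-- If the target values satisfy all constraints up to `0`, they form a valid assignment. -/
theorem isValid_of_excess_nonpos (ha : ∀ v, 0 ≤ a v) (h : ∀ w, excess G a w ≤ 0) : IsValid G a :=
  ⟨ha, fun w => by have := h w; unfold excess at this; linarith⟩

/-- The part of the violation at `w` that is due to a set `T` of children of `w` is paid for by
the deviation of any valid assignment on `T` and `w`. -/
theorem sum_sub_le_deviation {y : V → ℝ} (hy : IsValid G y) {w : V} {T : Finset V}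
    (hT : ∀ u ∈ T, G.Adj u w) (hw : w ∉ T) :
    ∑ u ∈ T, a u - a w ≤ ∑ v ∈ insert w T, |a v - y v| := by
  rw [sum_insert hw]
  have h1 : ∑ u ∈ T, y u ≤ y w :=
    (sum_le_sum_of_subset_of_nonneg (fun u hu => by simpa using hT u hu)
      fun u _ _ => hy.1 u).trans (hy.2 w)
  have h2 : ∑ u ∈ T, a u - ∑ u ∈ T, y u ≤ ∑ u ∈ T, |a u - y u| := by
    rw [← sum_sub_distrib]
    exact sum_le_sum fun u _ => le_abs_self _
  have h3 := neg_abs_le (a w - y w)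
  linarith

theorem excess_le_l1Cost (hG : ∀ w, ¬ G.Adj w w) {y : V → ℝ} (hy : IsValid G y) (w : V) :
    excess G a w ≤ l1Cost a y :=
  (sum_sub_le_deviation hy (T := univ.filter fun u => G.Adj u w) (by simp) (by simp [hG w])).trans
    (sum_le_sum_of_subset_of_nonneg (subset_univ _) fun _ _ _ => abs_nonneg _)

/-- A violated constraint bounds the total length that a push multiplies by `1 + e`. -/
theorem sum_len_lt_of_violated (hG : ∀ w, ¬ G.Adj w w) {θ : ℝ} {ℓ : V → ℝ} {w : V}
    (h : θ * a w + ℓ w < demand G a θ ℓ w) :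
    ∑ v ∈ insert w (active G a θ ℓ w), ℓ v < θ * (∑ u ∈ active G a θ ℓ w, a u - a w) := by
  rw [sum_insert (by simp [active, hG w])]
  rw [demand, sum_sub_distrib, ← mul_sum] at h
  linarith

theorem le_push (θ e : ℝ) (k : V → ℕ) (w v : V) : k v ≤ push G a θ e k w v := Nat.le_add_right _ _

theorem sum_push_gt (θ e : ℝ) (k : V → ℕ) (w : V) : ∑ v, k v < ∑ v, push G a θ e k w v :=
  sum_lt_sum (fun v _ => le_push θ e k w v) ⟨w, mem_univ _, by simp [push]⟩

theorem len_mono {e : ℝ} (he : 0 ≤ e) {k k' : V → ℕ} (h : ∀ v, k v ≤ k' v) (v : V) :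
    len e k v ≤ len e k' v := pow_le_pow_right₀ (by linarith) (h v)

theorem len_pos {e : ℝ} (he : 0 ≤ e) (k : V → ℕ) (v : V) : 0 < len e k v := by
  unfold len; positivity

theorem len_push (θ e : ℝ) (k : V → ℕ) (w v : V) :
    len e (push G a θ e k w) v =
      len e k v + if v ∈ insert w (active G a θ (len e k) w) then e * len e k v else 0 := by
  unfold push
  generalize insert w (active G a θ (len e k) w) = S
  unfold len
  by_cases h : v ∈ S
  · simp only [h, if_true]; ring
  · simp [h]

/-- Only lengths below `θ * B` are increased, where `B` bounds the violation by the target values.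
So in the phase with `θ * B = (1 + e) ^ p` no exponent grows beyond `p`. -/
theorem push_le (hG : ∀ w, ¬ G.Adj w w) (ha : ∀ v, 0 ≤ a v) {θ e B : ℝ} {p : ℕ} (he : 0 < e)
    (hθ : 0 ≤ θ) (hB : ∀ w, excess G a w ≤ B) (hp : θ * B ≤ (1 + e) ^ p) {k : V → ℕ}
    (hk : ∀ v, k v ≤ p) {w : V} (h : θ * a w + len e k w < demand G a θ (len e k) w) (v : V) :
    push G a θ e k w v ≤ p := by
  unfold push
  split_ifs with hv
  · have h1 : len e k v ≤ ∑ v ∈ insert w (active G a θ (len e k) w), len e k v :=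
      single_le_sum (fun v _ => (len_pos he.le k v).le) hv
    have h2 := sum_len_lt_of_violated hG h
    have h3 : ∑ u ∈ active G a θ (len e k) w, a u ≤ ∑ u ∈ univ.filter (fun u => G.Adj u w), a u :=
      sum_le_sum_of_subset_of_nonneg (fun u hu => by simp [active] at hu ⊢; exact hu.1)
        fun u _ _ => ha u
    have h4 := hB w
    unfold excess at h4
    have h5 : (1 + e) ^ k v < (1 + e) ^ p := by
      change len e k v < _
      have : θ * (∑ u ∈ active G a θ (len e k) w, a u - a w) ≤ θ * B :=
        mul_le_mul_of_nonneg_left (by linarith) hθ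
      linarith
    exact (pow_lt_pow_iff_right₀ (by linarith)).1 h5
  · exact hk v

/-- The potential of the exponents `k` with respect to an assignment `y`. -/
noncomputable def potential (a y : V → ℝ) (k : V → ℕ) : ℝ := ∑ v, |a v - y v| * k v

/-- Weak duality, step by step: the growth of the total length in a push is paid for by the growth
of the potential of any valid assignment. -/
theorem sum_len_push_le (hG : ∀ w, ¬ G.Adj w w) {θ e : ℝ} (he : 0 < e) (hθ : 0 ≤ θ) {k : V → ℕ}
    {w : V} (h : θ * a w + len e k w < demand G a θ (len e k) w) {y : V → ℝ} (hy : IsValid G y) :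
    ∑ v, len e (push G a θ e k w) v - ∑ v, len e k v ≤
      e * θ * (potential a y (push G a θ e k w) - potential a y k) := by
  have h1 : ∑ v, len e (push G a θ e k w) v - ∑ v, len e k v =
      e * ∑ v ∈ insert w (active G a θ (len e k) w), len e k v := by
    simp_rw [len_push]
    rw [sum_add_distrib, add_sub_cancel_left, sum_ite_mem, univ_inter, mul_sum]
  have h2 : potential a y (push G a θ e k w) - potential a y k =
      ∑ v ∈ insert w (active G a θ (len e k) w), |a v - y v| := by
    unfold potential push
    generalize insert w (active G a θ (len e k) w) = S
    rw [← sum_sub_distrib, ← univ_inter S, ← sum_ite_mem, univ_inter]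
    refine sum_congr rfl fun v _ => ?_
    split_ifs <;> push_cast <;> ring
  rw [h1, h2, mul_assoc]
  refine mul_le_mul_of_nonneg_left ((sum_len_lt_of_violated hG h).le.trans ?_) he.le
  refine mul_le_mul_of_nonneg_left (sum_sub_le_deviation hy (fun u hu => ?_) ?_) hθ
  · simp [active] at hu; exact hu.1
  · simp [active, hG w]

/-- The assignment obtained from lengths `ℓ` at scale `θ`: vertices with children are raised,
the others are lowered. -/
noncomputable def roundLen (G : Digraph V) (a : V → ℝ) (θ : ℝ) (ℓ : V → ℝ) (v : V) : ℝ :=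
  open Classical in
  if ∃ u, G.Adj u v then a v + ℓ v / θ else if ℓ v ≤ θ * a v then a v - ℓ v / θ else 0

theorem isValid_roundLen (hG : ∀ u v w, G.Adj u v → ¬ G.Adj v w) (ha : ∀ v, 0 ≤ a v) {θ : ℝ}
    (hθ : 0 < θ) {ℓ : V → ℝ} (hℓ : ∀ v, 0 ≤ ℓ v)
    (h : ∀ w, demand G a θ ℓ w ≤ θ * a w + ℓ w) : IsValid G (roundLen G a θ ℓ) := by
  have h0 : ∀ v, 0 ≤ roundLen G a θ ℓ v := fun v => by
    unfold roundLen
    split_ifs with h1 h2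
    · have := ha v; have := hℓ v; positivity
    · rw [sub_nonneg, div_le_iff₀ hθ]; linarith
    · exact le_rfl
  refine ⟨h0, fun w => ?_⟩
  by_cases hw : ∃ u, G.Adj u w
  · have h1 : ∀ u ∈ univ.filter (fun u => G.Adj u w),
        roundLen G a θ ℓ u = max 0 (θ * a u - ℓ u) / θ := by
      intro u hu
      simp only [mem_filter, mem_univ, true_and] at hu
      have h2 : ¬ ∃ t, G.Adj t u := fun ⟨t, ht⟩ => hG t u w ht hu
      rw [roundLen, if_neg h2]
      split_ifs with h3
      · rw [max_eq_right (by linarith)]; field_simp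
      · rw [max_eq_left (by linarith)]; simp
    rw [sum_congr rfl h1, ← sum_div, ← demand_eq_sum_max, roundLen, if_pos hw, div_le_iff₀ hθ,
      add_mul, div_mul_cancel₀ _ hθ.ne']
    linarith [h w]
  · rw [filter_false_of_mem (fun u _ hu => hw ⟨u, hu⟩), sum_empty]
    exact h0 w

theorem l1Cost_roundLen_le (ha : ∀ v, 0 ≤ a v) {θ : ℝ} (hθ : 0 < θ) {ℓ : V → ℝ}
    (hℓ : ∀ v, 0 ≤ ℓ v) : l1Cost a (roundLen G a θ ℓ) ≤ (∑ v, ℓ v) / θ := by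
  rw [l1Cost, sum_div]
  refine sum_le_sum fun v _ => ?_
  have h1 : 0 ≤ ℓ v / θ := div_nonneg (hℓ v) hθ.le
  unfold roundLen
  split_ifs with h2 h3
  · rw [sub_add_cancel_left, abs_neg, abs_of_nonneg h1]
  · rw [sub_sub_cancel, abs_of_nonneg h1]
  · rw [sub_zero, abs_of_nonneg (ha v), le_div_iff₀ hθ]; linarith

/-- The state after a number of phases: `k` are the exponents in the phase with scale `θ`, and
`best` is the least value of `(∑ v, len e k v) / θ` so far. For every valid assignment, either
`best` is small enough, or the total length is exponentially bounded by the potential. -/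
structure PhaseInv (G : Digraph V) [DecidableRel G.Adj] (a : V → ℝ) (e B : ℝ) (p : ℕ) (k : V → ℕ)
    (best : ℝ) : Prop where
  k_le : ∀ v, k v ≤ p
  best_le : best * ((1 + e) ^ p / B) ≤ ∑ v, len e k v
  bound : ∀ y, IsValid G y → best ≤ (1 + 8 * e) * l1Cost a y ∨
    ∑ v, len e k v ≤ Fintype.card V *
      Real.exp (e * (1 + e) / ((1 + 8 * e) * l1Cost a y) * potential a y k)

theorem PhaseInv.init {e B : ℝ} :
    PhaseInv G a e B 0 (fun _ => 0) (Fintype.card V * B) where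
  k_le _ := le_rfl
  best_le := by
    rcases eq_or_ne B 0 with rfl | hB
    · simp [len]
    · simp [len, hB]
  bound y _ := Or.inr (by simp [len, potential])

/-- While `best` exceeds `(1 + 8 * e)` times the cost of `y`, the scale is bounded by the total
length divided by this number, so that a phase multiplies the total length at most by the
exponential of the increase of the potential. -/
theorem PhaseInv.step {e B : ℝ} {p : ℕ} {k k' : V → ℕ} {best best' : ℝ} (he : 0 < e)
    (hB : 0 < B) (h : PhaseInv G a e B p k best) (hc : ∀ y, IsValid G y → 0 < l1Cost a y)
    (hk : ∀ v, k' v ≤ p + 1) (hbest : best' ≤ best)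
    (hbest' : best' * ((1 + e) ^ (p + 1) / B) ≤ ∑ v, len e k' v)
    (hgain : ∀ y, IsValid G y → ∑ v, len e k' v - ∑ v, len e k v ≤
      e * ((1 + e) ^ (p + 1) / B) * (potential a y k' - potential a y k))
    (hkk : ∀ v, k v ≤ k' v) :
    PhaseInv G a e B (p + 1) k' best' where
  k_le := hk
  best_le := hbest'
  bound y hy := by
    rcases h.bound y hy with h1 | h1
    · exact Or.inl (hbest.trans h1)
    rcases le_or_gt best ((1 + 8 * e) * l1Cost a y) with h2 | h2
    · exact Or.inl (hbest.trans h2)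
    right
    have hκ : 0 < (1 + 8 * e) * l1Cost a y := mul_pos (by linarith) (hc y hy)
    set κ := (1 + 8 * e) * l1Cost a y
    set Δ := potential a y k' - potential a y k with hΔ
    have hΔ0 : 0 ≤ Δ := by
      rw [hΔ, sub_nonneg]
      exact sum_le_sum fun v _ => mul_le_mul_of_nonneg_left (by exact_mod_cast hkk v) (abs_nonneg _)
    set D := ∑ v, len e k v
    have h3 : (1 + e) ^ p / B ≤ D / κ := by
      rw [le_div_iff₀ hκ, mul_comm]
      exact (mul_le_mul_of_nonneg_right h2.le (by positivity)).trans h.best_le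
    have h4 : ∑ v, len e k' v ≤ D * (1 + e * (1 + e) / κ * Δ) := by
      have h5 := hgain y hy
      have h6 : e * ((1 + e) ^ (p + 1) / B) * Δ ≤ e * (1 + e) * (D / κ) * Δ := by
        have : e * ((1 + e) ^ (p + 1) / B) = e * (1 + e) * ((1 + e) ^ p / B) := by ring
        rw [this]
        gcongr
      have h7 : D * (1 + e * (1 + e) / κ * Δ) = D + e * (1 + e) * (D / κ) * Δ := by ring
      rw [h7]; linarith
    have hD : 0 ≤ D := sum_nonneg fun v _ => (len_pos he.le k v).le
    calc ∑ v, len e k' v ≤ D * (1 + e * (1 + e) / κ * Δ) := h4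
      _ ≤ D * Real.exp (e * (1 + e) / κ * Δ) := by
        gcongr
        rw [add_comm]; exact Real.add_one_le_exp _
      _ ≤ Fintype.card V * Real.exp (e * (1 + e) / κ * potential a y k) *
          Real.exp (e * (1 + e) / κ * Δ) := by gcongr
      _ = _ := by rw [mul_assoc, ← Real.exp_add, hΔ]; ring_nf

/-- After `q / e` phases, where `(1 + e) ^ q` is at least the number of vertices, the best
assignment is within `1 + 8 * e` of the optimum. -/
theorem PhaseInv.best_le_mul {e B : ℝ} {p q : ℕ} {k : V → ℕ} {best : ℝ} (he : 0 < e)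
    (he' : e ≤ 1 / 8) (hB : 0 < B) (h : PhaseInv G a e B p k best)
    (hq : (Fintype.card V : ℝ) ≤ (1 + e) ^ q) (hp : (q : ℝ) ≤ p * e) {y : V → ℝ}
    (hy : IsValid G y) (hc : B ≤ l1Cost a y) : best ≤ (1 + 8 * e) * l1Cost a y := by
  rcases h.bound y hy with h1 | h1
  · exact h1
  by_contra! h2
  have hc0 : 0 < l1Cost a y := hB.trans_le hc
  set c := l1Cost a y
  have hpot : potential a y k ≤ c * p := by
    rw [potential, show c = ∑ v, |a v - y v| from rfl, sum_mul]
    exact sum_le_sum fun v _ =>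
      mul_le_mul_of_nonneg_left (by exact_mod_cast h.k_le v) (abs_nonneg _)
  have h3 : e * (1 + e) / ((1 + 8 * e) * c) * potential a y k ≤ e * (1 + e) / (1 + 8 * e) * p := by
    calc _ ≤ e * (1 + e) / ((1 + 8 * e) * c) * (c * p) := by gcongr
      _ = _ := by field_simp
  have h4 : (1 + e) ^ p < ∑ v, len e k v := by
    refine lt_of_lt_of_le ?_ h.best_le
    rw [mul_div_assoc', lt_div_iff₀ hB, mul_comm]
    have : B < best := by nlinarith
    exact mul_lt_mul_of_pos_right this (by positivity)
  have h5 : (1 + e) ^ p < (1 + e) ^ q * Real.exp (e * (1 + e) / (1 + 8 * e) * p) := by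
    refine h4.trans_le (h1.trans ?_)
    gcongr
  have hl1 : Real.log (1 + e) ≤ e := by
    have := Real.log_le_sub_one_of_pos (show 0 < 1 + e by linarith); linarith
  have hl2 : e * (1 - e) ≤ Real.log (1 + e) := by
    have := Real.one_sub_inv_le_log_of_pos (show 0 < 1 + e by linarith)
    refine le_trans ?_ this
    have h6 : 1 - (1 + e)⁻¹ = e / (1 + e) := by field_simp; ring
    rw [h6, le_div_iff₀ (by linarith)]
    nlinarith [pow_pos he 3]
  have h6 := Real.log_lt_log (by positivity) h5
  rw [Real.log_mul (by positivity) (by positivity), Real.log_exp, Real.log_pow, Real.log_pow] at h6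
  -- `(p - q) log (1 + e) ≥ p (1 - e) · e (1 - e)`, and `(1 - e)² (1 + 8 e) ≥ 1 + e`
  have h7 : (p : ℝ) * (1 - e) * (e * (1 - e)) ≤ (p - q) * Real.log (1 + e) := by
    have hpe : 0 ≤ (p : ℝ) * (1 - e) := mul_nonneg (Nat.cast_nonneg p) (by linarith)
    have hpe2 : 0 ≤ e * (1 - e) := mul_nonneg he.le (by linarith)
    exact mul_le_mul (by nlinarith) hl2 hpe2 (by nlinarith)
  have h8 : e * (1 + e) / (1 + 8 * e) * p ≤ (p : ℝ) * (1 - e) * (e * (1 - e)) := by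
    have h9 : (1 + e) / (1 + 8 * e) ≤ (1 - e) ^ 2 := by
      rw [div_le_iff₀ (by linarith)]
      nlinarith [pow_pos he 3]
    calc e * (1 + e) / (1 + 8 * e) * p = e * p * ((1 + e) / (1 + 8 * e)) := by ring
      _ ≤ e * p * (1 - e) ^ 2 := by gcongr
      _ = _ := by ring
  linarith

end Weights

end SumSmoothing

/-! ### The program -/

namespace SumSmoothing

open RealRAM Finset

section Programs

/- Storage. Arrays of natural numbers: `0`-`2` input, `3` index of the current edge, `4` current
vertex. Arrays of real numbers: `0` and `1` input, `2` output, `3` lengths, `4` the precision `e`,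
`5` the scale `θ`, `6` the greatest excess `B`, `7` demand, `8` the bound on the cost of the recorded
assignment, `9` the exponent `q`, `10` the number of rounds, `11` powers of `1 + e`, `12` the total
length. All but the input, the output and the lengths are scalar variables. -/

/-- The loop over all vertices; the vertex is in the natural variable `4`. -/
abbrev forVerts (body : Prog) : Prog := .forRange 4 0 body

/-- The loop over all edges; the index of the edge is in the natural variable `3`. -/
abbrev forEdges (body : Prog) : Prog := .forRange 3 1 body

/-- The tail of the current edge. -/
abbrev tailE : NExpr := .get 1 (.var 3)

/-- The head of the current edge. -/
abbrev headE : NExpr := .get 2 (.var 3)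

/-- The head of the current edge is the current vertex, and its tail `u` satisfies
`ℓ u ≤ θ * a u`. The lengths `ℓ` are in the real array `3`, the scale `θ` in the real
variable `5`. -/
def activeCond : Cond :=
  .and (.and (.nle headE (.var 4)) (.nle (.var 4) headE))
    (.rle (.get 3 tailE) (.mul (.var 5) (.get 1 tailE)))

/-- Stores `demand` at the current vertex in the real variable `7`. -/
def demandProg : Prog :=
  .seq (.letR 7 (.const 0)) (forEdges (.ite activeCond
    (.letR 7 (.add (.var 7) (.sub (.mul (.var 5) (.get 1 tailE)) (.get 3 tailE)))) .skip))

/-- Multiplies the lengths of the current vertex and of its active children by `1 + e`, where `e`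
is in the real variable `4`. -/
def pushProg : Prog :=
  .seq (forEdges (.ite activeCond
      (.setR 3 tailE (.mul (.get 3 tailE) (.add (.const 1) (.var 4)))) .skip))
    (.setR 3 (.var 4) (.mul (.get 3 (.var 4)) (.add (.const 1) (.var 4))))

/-- Examines the current vertex `w`: goes on to the next vertex if the demand at `w` is at most
`θ * a w + ℓ w`, and pushes otherwise. -/
def examineProg : Prog :=
  .seq demandProg (.ite (.rle (.var 7) (.add (.mul (.var 5) (.get 1 (.var 4))) (.get 3 (.var 4))))
    (.letN 4 (.add (.var 4) (.const 1))) pushProg)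

/-- Pushes until no vertex has a demand above `θ * a w + ℓ w`. -/
def phaseProg : Prog :=
  .seq (.letN 4 (.const 0)) (.loop (.not (.nle (.get 0 (.const 0)) (.var 4))) examineProg)

/-- Stores the total length in the real variable `12`. -/
def sumLenProg : Prog :=
  .seq (.letR 12 (.const 0)) (forVerts (.letR 12 (.add (.var 12) (.get 3 (.var 4)))))

/-- Writes the assignment `roundLen` into the output array and the bound on its cost into the real
variable `8`. -/
def recordProg : Prog :=
  .seq (.letR 8 (.div (.var 12) (.var 5)))
    (.seq
      (forVerts (.ite (.rle (.get 3 (.var 4)) (.mul (.var 5) (.get 1 (.var 4))))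
        (.setR 2 (.var 4) (.sub (.get 1 (.var 4)) (.div (.get 3 (.var 4)) (.var 5))))
        (.setR 2 (.var 4) (.const 0))))
      (forEdges (.setR 2 headE (.add (.get 1 headE) (.div (.get 3 headE) (.var 5))))))

/-- Stores the greatest `excess` (or `0`) in the real variable `6`, which is `0` initially. The
excess is computed as the demand for `θ = 1` while all lengths are still `0`. -/
def maxExcessProg : Prog :=
  .seq (.letR 5 (.const 1)) (forVerts (.seq demandProg
    (.ite (.rle (.sub (.var 7) (.get 1 (.var 4))) (.var 6)) .skip
      (.letR 6 (.sub (.var 7) (.get 1 (.var 4)))))))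

/-- Sets all lengths to `1` and the real variable `12` to the number of vertices. -/
def initLenProg : Prog :=
  .seq (.letR 12 (.const 0))
    (forVerts (.seq (.setR 3 (.var 4) (.const 1)) (.letR 12 (.add (.var 12) (.const 1)))))

/-- Stores in the real variable `9` the least `q` such that `(1 + e) ^ q` is at least the number of
vertices. -/
def exponentProg : Prog :=
  .seq (.letR 11 (.const 1)) (.seq (.letR 9 (.const 0)) (.loop (.not (.rle (.var 12) (.var 11)))
    (.seq (.letR 11 (.mul (.var 11) (.add (.const 1) (.var 4))))
      (.letR 9 (.add (.var 9) (.const 1))))))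

/-- Increases the scale, runs a phase, and records the resulting assignment if it is the best so
far. -/
def roundProg : Prog :=
  .seq (.letR 10 (.add (.var 10) (.const 1)))
    (.seq (.letR 5 (.mul (.var 5) (.add (.const 1) (.var 4))))
      (.seq phaseProg (.seq sumLenProg
        (.ite (.rle (.mul (.var 8) (.var 5)) (.var 12)) .skip recordProg))))

/-- Runs rounds until their number `p` satisfies `q ≤ p * e`. -/
def roundsProg : Prog := .loop (.not (.rle (.var 9) (.mul (.var 10) (.var 4)))) roundProg

/-- Stores `min ε 1 / 8` in the real variable `4`. -/
def precisionProg : Prog :=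
  .ite (.rle (.const 1) (.var 0)) (.letR 4 (.div (.const 1) (.const 8)))
    (.letR 4 (.div (.var 0) (.const 8)))

/-- The part of the computation for a positive greatest excess. -/
def approxProg : Prog :=
  .seq initLenProg (.seq exponentProg (.seq (.letR 10 (.const 0))
    (.seq (.letR 5 (.div (.const 1) (.var 6))) (.seq recordProg roundsProg))))

/-- The approximation algorithm. -/
def smoothProg : Prog :=
  .seq precisionProg (.seq maxExcessProg (.ite (.rle (.var 6) (.const 0))
    (forVerts (.setR 2 (.var 4) (.get 1 (.var 4)))) approxProg))

end Programs

/-! ### Correctness of the parts of the program -/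

section Correctness

variable {n : ℕ} {G : Digraph (Fin n)} [DecidableRel G.Adj] {edges : List (Fin n × Fin n)}
  {a : Fin n → ℝ}

/-- The graph and the target values are stored where the input has them. -/
structure HasInput (edges : List (Fin n × Fin n)) (a : Fin n → ℝ) (s : Store) : Prop where
  size : s.nat 0 0 = n
  length : s.nat 0 1 = edges.length
  tail : ∀ i (h : i < edges.length), s.nat 1 i = (edges[i].1 : ℕ)
  head : ∀ i (h : i < edges.length), s.nat 2 i = (edges[i].2 : ℕ)
  target : ∀ v : Fin n, s.real 1 v = a v

theorem HasInput.frame {s s' : Store} {p : Prog} (h : HasInput edges a s) (hF : Frame p s s')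
    (h0 : p.writesN 0 = false) (h1 : p.writesN 1 = false) (h2 : p.writesN 2 = false)
    (h3 : p.writesR 1 = false) : HasInput edges a s' := by
  constructor
  · rw [hF.nat 0 h0, h.size]
  · rw [hF.nat 0 h0, h.length]
  · rw [hF.nat 1 h1]; exact h.tail
  · rw [hF.nat 2 h2]; exact h.head
  · rw [hF.real 1 h3]; exact h.target

theorem hasInput_inputStore (ε : ℝ) : HasInput edges a (inputStore edges a ε) := by
  constructor <;> simp +contextual [inputStore, inputNat, inputReal]

/-- The real array `3` holds the lengths `ℓ`. -/
def HasLen (ℓ : Fin n → ℝ) (s : Store) : Prop := ∀ v : Fin n, s.real 3 v = ℓ v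

theorem activeCond_iff {s : Store} (h : HasInput edges a s) {ℓ : Fin n → ℝ} (hℓ : HasLen ℓ s)
    {i : ℕ} (hi : i < edges.length) (hs : s.nat 3 0 = i) {w : Fin n} (hw : s.nat 4 0 = w) :
    activeCond.holds s ↔ edges[i].2 = w ∧ ℓ edges[i].1 ≤ s.real 5 0 * a edges[i].1 := by
  simp only [activeCond, Cond.holds, NExpr.eval, RExpr.eval, hs, h.tail i hi, h.head i hi, hw,
    h.target, hℓ _, Fin.ext_iff]
  rw [le_antisymm_iff]

theorem sum_map_edges (hE : IsEdgeList G edges) (θ : ℝ) (ℓ : Fin n → ℝ) (w : Fin n) :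
    (edges.map fun x => if x.2 = w ∧ ℓ x.1 ≤ θ * a x.1 then θ * a x.1 - ℓ x.1 else 0).sum =
      demand G a θ ℓ w := by
  rw [← List.sum_toFinset _ hE.1, ← sum_filter, demand]
  refine sum_bij' (fun x _ => x.1) (fun u _ => (u, w)) ?_ ?_ ?_ ?_ ?_
  · rintro ⟨u, v⟩ hx
    simp only [mem_filter, List.mem_toFinset, hE.2] at hx
    obtain ⟨h1, rfl, h2⟩ := hx
    simp [active, h1, h2]
  · intro u hu
    simpa [active, hE.2] using hu
  · rintro ⟨u, v⟩ hx
    simp only [mem_filter] at hx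
    simp [hx.2.1]
  · simp
  · simp

theorem run_demandProg (hE : IsEdgeList G edges) {s : Store} (h : HasInput edges a s)
    {ℓ : Fin n → ℝ} (hℓ : HasLen ℓ s) {w : Fin n} (hw : s.nat 4 0 = w) :
    Run demandProg s (70 * (edges.length + 1))
      (fun s' => s'.real 7 0 = demand G a (s.real 5 0) ℓ w) := by
  rw [← sum_map_edges hE]
  set g : Fin n × Fin n → ℝ := fun x =>
    if x.2 = w ∧ ℓ x.1 ≤ s.real 5 0 * a x.1 then s.real 5 0 * a x.1 - ℓ x.1 else 0 with hg
  refine Run.mono (T := 3 + (edges.length * (50 + 13) + 10)) (Run.seq (Run.mono (Run.setR ?_)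
    (T' := 3) (by simp [NExpr.cost, RExpr.cost]) (fun _ _ h => h))) (by omega) (fun _ _ h => h)
  set s0 := s.writeR 7 ((NExpr.const 0).eval s) ((RExpr.const 0).eval s) with hs0
  have hF0 : Frame (.letR 7 (.const 0)) s s0 := Exec.frame (.setR s 7 (.const 0) (.const 0))
  have h0 : HasInput edges a s0 := h.frame hF0 rfl rfl rfl rfl
  have := Run.forRange (v := 3) (b := 1) (s := s0) (c := 50) (body := .ite activeCond
    (.letR 7 (.add (.var 7) (.sub (.mul (.var 5) (.get 1 tailE)) (.get 3 tailE)))) .skip)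
    (fun i s' => s'.real 7 0 = ((edges.take i).map g).sum) (by norm_num) rfl rfl
    (fun i s' x h => h) (by simp [hs0, Store.writeR, NExpr.eval, RExpr.eval]) ?_
  · rw [h0.length] at this
    exact this.mono le_rfl fun s' _ h => by simpa using h
  intro i s' hi hF hvi hI
  rw [h0.length] at hi
  have h' : HasInput edges a s' := h0.frame hF rfl rfl rfl rfl
  have hℓ' : HasLen ℓ s' := fun v => by
    rw [hF.real 3 rfl, hF0.real 3 rfl, hℓ v]
  have h5 : s'.real 5 = s.real 5 := by rw [hF.real 5 rfl, hF0.real 5 rfl]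
  have hw' : s'.nat 4 0 = w := by rw [hF.nat 4 rfl, hF0.nat 4 rfl, hw]
  have hiff := activeCond_iff h' hℓ' hi hvi hw'
  rw [h5] at hiff
  rw [List.map_take, List.sum_take_succ _ _ (by simpa using hi), List.getElem_map, hg]
  beta_reduce
  rw [← hg]
  refine (Run.ite (T := 20) (fun hc => ?_) (fun hc => ?_)).mono ?_ (fun _ _ h => h)
  · refine (Run.setR ?_).mono ?_ (fun _ _ h => h)
    · rw [if_pos (hiff.1 hc)]
      simp [Store.writeR, NExpr.eval, RExpr.eval, hI, hvi, h'.tail i hi, h'.target, hℓ' _, h5]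
    · simp [NExpr.cost, RExpr.cost]
  · refine (Run.skip ?_).mono (by norm_num) (fun _ _ h => h)
    rw [if_neg (mt hiff.2 hc), hI, add_zero, List.map_take]
  · simp [activeCond, Cond.cost, NExpr.cost, RExpr.cost]

theorem mem_take_succ {α : Type*} {l : List α} {i : ℕ} (hi : i < l.length) (x : α) :
    x ∈ l.take (i + 1) ↔ x ∈ l.take i ∨ x = l[i] := by
  rw [List.take_succ_eq_append_getElem hi, List.mem_append, List.mem_singleton]

theorem run_pushProg (hG : ∀ w, ¬ G.Adj w w) (hE : IsEdgeList G edges) {s : Store}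
    (h : HasInput edges a s) {e : ℝ} (he : s.real 4 0 = e) {k : Fin n → ℕ}
    (hℓ : HasLen (len e k) s) {w : Fin n} (hw : s.nat 4 0 = w) :
    Run pushProg s (70 * (edges.length + 1)) (HasLen (len e (push G a (s.real 5 0) e k w))) := by
  set θ := s.real 5 0
  set A := active G a θ (len e k) w with hA
  have hwA : w ∉ A := by simp [hA, active, hG w]
  have hmem : ∀ v, v ∈ A ↔ (v, w) ∈ edges ∧ len e k v ≤ θ * a v := fun v => by
    simp [hA, active, hE.2]
  refine Run.mono (T := edges.length * (50 + 13) + 10 + 13) (Run.seq ?_) (by omega)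
    (fun _ _ h => h)
  have := Run.forRange (v := 3) (b := 1) (s := s) (c := 50) (body := .ite activeCond
    (.setR 3 tailE (.mul (.get 3 tailE) (.add (.const 1) (.var 4)))) .skip)
    (fun i s' => ∀ v : Fin n, s'.real 3 v = len e k v +
      if (v, w) ∈ edges.take i ∧ len e k v ≤ θ * a v then e * len e k v else 0)
    (by norm_num) rfl rfl (fun i s' x h => h) (fun v => by simpa using hℓ v) ?_
  · rw [h.length] at this
    refine this.mono le_rfl fun s' hF hs' => (Run.setR ?_).mono ?_ (fun _ _ h => h)
    · intro v
      have hw' : s'.nat 4 0 = w := by rw [hF.nat 4 rfl, hw]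
      have he' : s'.real 4 0 = e := by rw [hF.real 4 rfl, he]
      have h3 : ∀ v : Fin n, s'.real 3 v = len e k v + if v ∈ A then e * len e k v else 0 := by
        intro v; rw [hs' v]; simp [hmem]
      rw [len_push, ← hA]
      by_cases hv : v = w
      · subst hv
        simp [Store.writeR, NExpr.eval, RExpr.eval, hw', h3, he', hwA]
        ring
      · have hv' : (v : ℕ) ≠ w := fun h => hv (Fin.ext h)
        simp [Store.writeR, NExpr.eval, hw', hv', h3, hv]
    · simp [NExpr.cost, RExpr.cost]
  intro i s' hi hF hvi hI
  rw [h.length] at hi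
  have h' : HasInput edges a s' := h.frame hF rfl rfl rfl rfl
  have h5 : s'.real 5 0 = θ := by rw [hF.real 5 rfl]
  have hw' : s'.nat 4 0 = w := by rw [hF.nat 4 rfl, hw]
  have he' : s'.real 4 0 = e := by rw [hF.real 4 rfl, he]
  have htake : ∀ x, x ∈ edges.take (i + 1) ↔ x ∈ edges.take i ∨ x = edges[i] := mem_take_succ hi
  -- the current edge comes only once, so the length of its tail is still the original one
  have hnew : edges[i] ∉ edges.take i := by
    intro hmem
    obtain ⟨j, hj, hji⟩ := List.getElem_of_mem hmem
    rw [List.getElem_take, hE.1.getElem_inj_iff] at hji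
    simp at hj; omega
  obtain ⟨⟨u, w'⟩, hx⟩ : ∃ x, x = edges[i] := ⟨_, rfl⟩
  have hcond : activeCond.holds s' ↔ w' = w ∧ s'.real 3 u ≤ θ * a u := by
    simp only [activeCond, Cond.holds, NExpr.eval, RExpr.eval, hvi, h'.tail i hi, h'.head i hi,
      hw', h'.target, ← hx, h5, Fin.ext_iff]
    rw [le_antisymm_iff]
  rw [← hx] at hnew
  simp only [← hx] at htake
  refine (Run.ite (T := 20) (fun hc => ?_) (fun hc => ?_)).mono ?_ (fun _ _ h => h)
  · obtain ⟨rfl, hc2⟩ := hcond.1 hc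
    have h3 : s'.real 3 u = len e k u := by rw [hI, if_neg (fun h => hnew h.1), add_zero]
    rw [h3] at hc2
    refine (Run.setR fun v => ?_).mono ?_ (fun _ _ h => h)
    · by_cases hv : v = u
      · subst hv
        simp [Store.writeR, NExpr.eval, RExpr.eval, hvi, h'.tail i hi, ← hx, h3, he', htake, hc2]
        ring
      · have hv' : (v : ℕ) ≠ u := fun h => hv (Fin.ext h)
        simp [Store.writeR, NExpr.eval, hvi, h'.tail i hi, ← hx, htake, hv, hv', hI]
    · simp [NExpr.cost, RExpr.cost]
  · refine (Run.skip fun v => ?_).mono (by norm_num) (fun _ _ h => h)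
    rw [hI v]
    congr 1
    refine if_congr ?_ rfl rfl
    rw [htake]
    refine ⟨fun h => ⟨Or.inl h.1, h.2⟩, fun h => ⟨h.1.resolve_right ?_, h.2⟩⟩
    rintro heq
    obtain ⟨rfl, rfl⟩ := Prod.mk.inj heq
    refine hc (hcond.2 ⟨rfl, ?_⟩)
    rw [hI, if_neg (fun h => hnew h.1), add_zero]
    exact h.2
  · simp [activeCond, Cond.cost, NExpr.cost, RExpr.cost]

theorem run_sumLenProg {s : Store} (h : HasInput edges a s) {ℓ : Fin n → ℝ} (hℓ : HasLen ℓ s) :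
    Run sumLenProg s (40 * (n + 1)) (fun s' => s'.real 12 0 = ∑ v, ℓ v) := by
  refine Run.mono (T := 3 + (n * (20 + 13) + 10)) (Run.seq (Run.mono (Run.setR ?_)
    (T' := 3) (by simp [NExpr.cost, RExpr.cost]) (fun _ _ h => h))) (by omega) (fun _ _ h => h)
  set s0 := s.writeR 12 ((NExpr.const 0).eval s) ((RExpr.const 0).eval s) with hs0
  have hF0 : Frame (.letR 12 (.const 0)) s s0 := Exec.frame (.setR s 12 (.const 0) (.const 0))
  have h0 : HasInput edges a s0 := h.frame hF0 rfl rfl rfl rfl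
  have := Run.forRange (v := 4) (b := 0) (s := s0) (c := 20)
    (body := .letR 12 (.add (.var 12) (.get 3 (.var 4))))
    (fun i s' => s'.real 12 0 = ∑ j ∈ range i, s.real 3 j) (by norm_num) rfl rfl
    (fun i s' x h => h) (by simp [hs0, Store.writeR, NExpr.eval, RExpr.eval]) ?_
  · rw [h0.size] at this
    refine this.mono le_rfl fun s' _ h => ?_
    rw [h, ← Fin.sum_univ_eq_sum_range]
    exact sum_congr rfl fun v _ => hℓ v
  intro i s' hi hF hvi hI
  have h3 : s'.real 3 = s.real 3 := by rw [hF.real 3 rfl, hF0.real 3 rfl]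
  refine (Run.setR ?_).mono ?_ (fun _ _ h => h)
  · simp [Store.writeR, NExpr.eval, RExpr.eval, hI, hvi, h3, sum_range_succ]
  · simp [NExpr.cost, RExpr.cost]

theorem run_initLenProg {s : Store} (h : HasInput edges a s) :
    Run initLenProg s (40 * (n + 1)) (fun s' => HasLen (fun _ : Fin n => 1) s' ∧
      s'.real 12 0 = n) := by
  refine Run.mono (T := 3 + (n * (20 + 13) + 10)) (Run.seq (Run.mono (Run.setR ?_)
    (T' := 3) (by simp [NExpr.cost, RExpr.cost]) (fun _ _ h => h))) (by omega) (fun _ _ h => h)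
  set s0 := s.writeR 12 ((NExpr.const 0).eval s) ((RExpr.const 0).eval s) with hs0
  have hF0 : Frame (.letR 12 (.const 0)) s s0 := Exec.frame (.setR s 12 (.const 0) (.const 0))
  have h0 : HasInput edges a s0 := h.frame hF0 rfl rfl rfl rfl
  have := Run.forRange (v := 4) (b := 0) (s := s0) (c := 20)
    (body := .seq (.setR 3 (.var 4) (.const 1)) (.letR 12 (.add (.var 12) (.const 1))))
    (fun i s' => (∀ j < i, s'.real 3 j = 1) ∧ s'.real 12 0 = i) (by norm_num) rfl rfl
    (fun i s' x h => h) (by simp [hs0, Store.writeR, NExpr.eval, RExpr.eval]) ?_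
  · rw [h0.size] at this
    exact this.mono le_rfl fun s' _ h => ⟨fun v => h.1 v v.2, h.2⟩
  intro i s' hi hF hvi hI
  refine Run.mono (T := 4 + 6) (Run.seq ((Run.setR ((Run.setR ?_).mono (T' := 6) ?_
    (fun _ _ h => h))).mono ?_ (fun _ _ h => h))) (by norm_num) (fun _ _ h => h)
  · refine ⟨fun j hj => ?_, ?_⟩
    · rcases Nat.lt_succ_iff_lt_or_eq.1 hj with hj | rfl
      · simp [Store.writeR, NExpr.eval, hvi, hj.ne, hI.1 j hj]
      · simp [Store.writeR, NExpr.eval, RExpr.eval, hvi]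
    · simp [Store.writeR, NExpr.eval, RExpr.eval, hI.2]
  · simp [NExpr.cost, RExpr.cost]
  · simp [NExpr.cost, RExpr.cost]

theorem run_recordProg (hE : IsEdgeList G edges) {s : Store} (h : HasInput edges a s)
    {ℓ : Fin n → ℝ} (hℓ : HasLen ℓ s) :
    Run recordProg s (60 * (n + edges.length + 1)) (fun s' =>
      s'.real 8 0 = s.real 12 0 / s.real 5 0 ∧ output n s' = roundLen G a (s.real 5 0) ℓ) := by
  refine Run.mono (T := 7 + ((n * (40 + 13) + 10) + (edges.length * (20 + 13) + 10)))
    (Run.seq (Run.mono (Run.setR (Run.seq ?_)) (T' := 7) (by simp [NExpr.cost, RExpr.cost])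
      (fun _ _ h => h))) (by omega) (fun _ _ h => h)
  set s0 := s.writeR 8 ((NExpr.const 0).eval s) (((RExpr.var 12).div (.var 5)).eval s) with hs0
  have hF0 : Frame (.letR 8 (.div (.var 12) (.var 5))) s s0 :=
    Exec.frame (.setR s 8 (.const 0) (.div (.var 12) (.var 5)))
  have h0 : HasInput edges a s0 := h.frame hF0 rfl rfl rfl rfl
  have h8 : s0.real 8 0 = s.real 12 0 / s.real 5 0 := by
    simp [hs0, Store.writeR, NExpr.eval, RExpr.eval]
  have hℓ0 : HasLen ℓ s0 := fun v => by rw [hF0.real 3 rfl, hℓ v]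
  have h5 : s0.real 5 = s.real 5 := hF0.real 5 rfl
  set θ := s.real 5 0
  set low : Fin n → ℝ := fun v => if ℓ v ≤ θ * a v then a v - ℓ v / θ else 0 with hlow
  have := Run.forRange (v := 4) (b := 0) (s := s0) (c := 40)
    (body := .ite (.rle (.get 3 (.var 4)) (.mul (.var 5) (.get 1 (.var 4))))
        (.setR 2 (.var 4) (.sub (.get 1 (.var 4)) (.div (.get 3 (.var 4)) (.var 5))))
        (.setR 2 (.var 4) (.const 0)))
    (fun i s' => ∀ v : Fin n, (v : ℕ) < i → s'.real 2 v = low v) (by norm_num) rfl rfl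
    (fun i s' x h => h) (by simp) ?_
  · rw [h0.size] at this
    refine this.mono le_rfl fun s1 hF1 hs1 => ?_
    have h1 : HasInput edges a s1 := h0.frame hF1 rfl rfl rfl rfl
    have hℓ1 : HasLen ℓ s1 := fun v => by rw [hF1.real 3 rfl, hℓ0 v]
    have h51 : s1.real 5 0 = θ := by rw [hF1.real 5 rfl, h5]
    have := Run.forRange (v := 3) (b := 1) (s := s1) (c := 20)
      (body := .setR 2 headE (.add (.get 1 headE) (.div (.get 3 headE) (.var 5))))
      (fun i s' => ∀ v : Fin n, s'.real 2 v =
        open Classical in if ∃ u, (u, v) ∈ edges.take i then a v + ℓ v / θ else low v)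
      (by norm_num) rfl rfl (fun i s' x h => h) (by simpa using fun v : Fin n => hs1 v v.2) ?_
    · rw [h1.length] at this
      refine this.mono le_rfl fun s2 hF2 hs2 => ⟨?_, ?_⟩
      · rw [hF2.real 8 rfl, hF1.real 8 rfl, h8]
      · ext v
        rw [output, hs2 v, roundLen]
        simp [hE.2, hlow]
    intro i s' hi hF hvi hI
    rw [h1.length] at hi
    have h' : HasInput edges a s' := h1.frame hF rfl rfl rfl rfl
    have hℓ' : HasLen ℓ s' := fun v => by rw [hF.real 3 rfl, hℓ1 v]
    have h5' : s'.real 5 0 = θ := by rw [hF.real 5 rfl, h51]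
    have htake : ∀ x, x ∈ edges.take (i + 1) ↔ x ∈ edges.take i ∨ x = edges[i] := mem_take_succ hi
    obtain ⟨⟨u, w⟩, hx⟩ : ∃ x, x = edges[i] := ⟨_, rfl⟩
    simp only [← hx] at htake
    refine (Run.setR fun v => ?_).mono ?_ (fun _ _ h => h)
    · by_cases hv : v = w
      · subst hv
        rw [if_pos ⟨u, (htake _).2 (Or.inr rfl)⟩]
        simp [Store.writeR, NExpr.eval, RExpr.eval, hvi, h'.head i hi, ← hx, h'.target, hℓ' _, h5']
      · have hv' : (v : ℕ) ≠ w := fun h => hv (Fin.ext h)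
        simp [Store.writeR, NExpr.eval, hvi, h'.head i hi, ← hx, htake, hv, hv', hI]
    · simp [NExpr.cost, RExpr.cost]
  intro i s' hi hF hvi hI
  rw [h0.size] at hi
  have h' : HasInput edges a s' := h0.frame hF rfl rfl rfl rfl
  have hℓ' : HasLen ℓ s' := fun v => by rw [hF.real 3 rfl, hℓ0 v]
  have h5' : s'.real 5 0 = θ := by rw [hF.real 5 rfl, h5]
  have hai : s'.real 1 i = a ⟨i, hi⟩ := h'.target ⟨i, hi⟩
  have hli : s'.real 3 i = ℓ ⟨i, hi⟩ := hℓ' ⟨i, hi⟩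
  refine (Run.ite (T := 15) (fun hc => ?_) (fun hc => ?_)).mono ?_ (fun _ _ h => h)
  · simp only [Cond.holds, RExpr.eval, NExpr.eval, hvi, h5', hai, hli] at hc
    refine (Run.setR fun v hv => ?_).mono ?_ (fun _ _ h => h)
    · rcases Nat.lt_succ_iff_lt_or_eq.1 hv with hv | hv
      · simp [Store.writeR, NExpr.eval, hvi, hv.ne, hI v hv]
      · obtain rfl : v = ⟨i, hi⟩ := Fin.ext hv
        simp [Store.writeR, NExpr.eval, RExpr.eval, hvi, hai, hli, h5', hlow, hc]
    · simp [NExpr.cost, RExpr.cost]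
  · simp only [Cond.holds, RExpr.eval, NExpr.eval, hvi, h5', hai, hli] at hc
    refine (Run.setR fun v hv => ?_).mono ?_ (fun _ _ h => h)
    · rcases Nat.lt_succ_iff_lt_or_eq.1 hv with hv | hv
      · simp [Store.writeR, NExpr.eval, hvi, hv.ne, hI v hv]
      · obtain rfl : v = ⟨i, hi⟩ := Fin.ext hv
        simp [Store.writeR, NExpr.eval, RExpr.eval, hvi, hlow, hc]
    · simp [NExpr.cost, RExpr.cost]
  · simp [Cond.cost, NExpr.cost, RExpr.cost]

theorem run_maxExcessProg (ha : ∀ v, 0 ≤ a v) (hE : IsEdgeList G edges) {s : Store}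
    (h : HasInput edges a s) (hℓ : HasLen (fun _ : Fin n => 0) s) (hB : s.real 6 0 = 0) :
    Run maxExcessProg s (130 * (n + 1) * (edges.length + 1)) (fun s' =>
      (∀ w, excess G a w ≤ s'.real 6 0) ∧
        (0 < s'.real 6 0 → ∃ w, s'.real 6 0 = excess G a w)) := by
  refine Run.mono (T := 3 + (n * ((70 * (edges.length + 1) + 40) + 13) + 10))
    (Run.seq (Run.mono (Run.setR ?_) (T' := 3) (by simp [NExpr.cost, RExpr.cost])
      (fun _ _ h => h))) (by
        generalize edges.length = m
        have := Nat.zero_le (n * m)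
        linarith) (fun _ _ h => h)
  set s0 := s.writeR 5 ((NExpr.const 0).eval s) ((RExpr.const 1).eval s) with hs0
  have hF0 : Frame (.letR 5 (.const 1)) s s0 := Exec.frame (.setR s 5 (.const 0) (.const 1))
  have h0 : HasInput edges a s0 := h.frame hF0 rfl rfl rfl rfl
  have h5 : s0.real 5 0 = 1 := by simp [hs0, Store.writeR, NExpr.eval, RExpr.eval]
  have hB0 : s0.real 6 0 = 0 := by rw [hF0.real 6 rfl, hB]
  have := Run.forRange (v := 4) (b := 0) (s := s0) (c := 70 * (edges.length + 1) + 40)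
    (body := .seq demandProg (.ite (.rle (.sub (.var 7) (.get 1 (.var 4))) (.var 6)) .skip
      (.letR 6 (.sub (.var 7) (.get 1 (.var 4))))))
    (fun i s' => (∀ w : Fin n, (w : ℕ) < i → excess G a w ≤ s'.real 6 0) ∧
      (0 < s'.real 6 0 → ∃ w, s'.real 6 0 = excess G a w)) (by norm_num) rfl rfl
    (fun i s' x h => h) ⟨by simp, by simp [hB0]⟩ ?_
  · rw [h0.size] at this
    exact this.mono le_rfl fun s' _ h => ⟨fun w => h.1 w w.2, h.2⟩
  intro i s' hi hF hvi hI
  rw [h0.size] at hi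
  set w : Fin n := ⟨i, hi⟩ with hw
  have h' : HasInput edges a s' := h0.frame hF rfl rfl rfl rfl
  have hℓ' : HasLen (fun _ : Fin n => 0) s' := fun v => by
    rw [hF.real 3 rfl, hF0.real 3 rfl, hℓ v]
  have h5' : s'.real 5 0 = 1 := by rw [hF.real 5 rfl, h5]
  refine Run.seq ((run_demandProg hE h' hℓ' (w := w) hvi).mono le_rfl fun s1 hF1 hs1 => ?_)
  have hai : s1.real 1 i = a w := by rw [hF1.real 1 rfl]; exact h'.target w
  have hv1 : s1.nat 4 0 = i := by rw [hF1.nat 4 rfl, hvi]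
  have h61 : s1.real 6 = s'.real 6 := hF1.real 6 rfl
  -- with `θ = 1` and zero lengths every child is active
  have hex : s1.real 7 0 - a w = excess G a w := by
    rw [hs1, h5', excess, demand]
    congr 1
    have : active G a 1 (fun _ => 0) w = univ.filter fun u => G.Adj u w := by
      simp [active, ha]
    rw [this]
    simp
  refine (Run.ite (T := 20) (fun hc => ?_) (fun hc => ?_)).mono ?_ (fun _ _ h => h)
  · simp only [Cond.holds, RExpr.eval, NExpr.eval, hv1, hai, hex] at hc
    refine (Run.skip ⟨fun v hv => ?_, ?_⟩).mono (by norm_num) (fun _ _ h => h)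
    · rcases Nat.lt_succ_iff_lt_or_eq.1 hv with hv | hv
      · rw [h61]; exact hI.1 v hv
      · obtain rfl : v = w := Fin.ext hv
        exact hc
    · rw [h61]; exact hI.2
  · simp only [Cond.holds, RExpr.eval, NExpr.eval, hv1, hai, hex, not_le] at hc
    refine (Run.setR ?_).mono ?_ (fun _ _ h => h)
    · have h6 : (s1.writeR 6 ((NExpr.const 0).eval s1)
          (((RExpr.var 7).sub (.get 1 (.var 4))).eval s1)).real 6 0 = excess G a w := by
        simp [Store.writeR, NExpr.eval, RExpr.eval, hv1, hai, hex]
      rw [h6]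
      refine ⟨fun v hv => ?_, fun _ => ⟨w, rfl⟩⟩
      rcases Nat.lt_succ_iff_lt_or_eq.1 hv with hv | hv
      · rw [h61] at hc; exact (hI.1 v hv).trans hc.le
      · obtain rfl : v = w := Fin.ext hv
        exact le_rfl
    · simp [NExpr.cost, RExpr.cost]
  · simp [Cond.cost, NExpr.cost, RExpr.cost]

end Correctness

end SumSmoothing

/-! ### Rounds, termination and running time -/

namespace SumSmoothing

open RealRAM Finset

section Rounds

variable {n : ℕ} {G : Digraph (Fin n)} [DecidableRel G.Adj] {edges : List (Fin n × Fin n)}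
  {a : Fin n → ℝ}

/-- Examining a vertex `w` either advances to the next vertex or pushes at `w`. -/
theorem run_examineProg (hG : ∀ w, ¬ G.Adj w w) (hE : IsEdgeList G edges) {s : Store}
    (h : HasInput edges a s) {e : ℝ} (he : s.real 4 0 = e) {k : Fin n → ℕ}
    (hℓ : HasLen (len e k) s) {θ : ℝ} (hθ : s.real 5 0 = θ) {w : Fin n} (hw : s.nat 4 0 = w) :
    Run examineProg s (170 * (edges.length + 1)) (fun s' =>
      (demand G a θ (len e k) w ≤ θ * a w + len e k w ∧ s'.nat 4 0 = w + 1 ∧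
        HasLen (len e k) s') ∨
      (θ * a w + len e k w < demand G a θ (len e k) w ∧ s'.nat 4 0 = w ∧
        HasLen (len e (push G a θ e k w)) s')) := by
  subst hθ
  refine Run.mono (T := 70 * (edges.length + 1) + (17 + 1 + 70 * (edges.length + 1)))
    (Run.seq ((run_demandProg hE h hℓ hw).mono le_rfl fun s1 hF1 hs1 => ?_)) (by omega)
    (fun _ _ h => h)
  have h1 : HasInput edges a s1 := h.frame hF1 rfl rfl rfl rfl
  have hw1 : s1.nat 4 0 = w := by rw [hF1.nat 4 rfl, hw]
  have hℓ1 : HasLen (len e k) s1 := fun v => by rw [hF1.real 3 rfl, hℓ v]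
  have h51 : s1.real 5 0 = s.real 5 0 := by rw [hF1.real 5 rfl]
  have he1 : s1.real 4 0 = e := by rw [hF1.real 4 rfl, he]
  refine (Run.ite (T := 70 * (edges.length + 1)) (fun hc => ?_) (fun hc => ?_)).mono ?_
    (fun _ _ h => h)
  · simp only [Cond.holds, RExpr.eval, NExpr.eval, hw1, h1.target, hℓ1 w, h51, hs1] at hc
    refine (Run.setN (Or.inl ⟨hc, ?_, fun v => ?_⟩)).mono ?_ (fun _ _ h => h)
    · simp [NExpr.cost]; omega
    · simp [Store.writeN, NExpr.eval, hw1]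
    · exact hℓ1 v
  · simp only [Cond.holds, RExpr.eval, NExpr.eval, hw1, h1.target, hℓ1 w, h51, hs1, not_le] at hc
    refine (run_pushProg hG hE h1 he1 hℓ1 hw1).mono le_rfl fun s2 hF2 hs2 =>
      Or.inr ⟨hc, ?_, ?_⟩
    · rw [hF2.nat 4 rfl, hw1]
    · rw [← h51]; exact hs2
  · simp [Cond.cost, NExpr.cost, RExpr.cost]

/-- A phase ends without violated constraints; its running time is paid for by the growth `r` of
the sum of all exponents, up to one examination for each vertex. -/
theorem run_phaseProg (hG : ∀ w, ¬ G.Adj w w) (hE : IsEdgeList G edges) (ha : ∀ v, 0 ≤ a v)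
    {s : Store} (h : HasInput edges a s) {e : ℝ} (he : s.real 4 0 = e) (he0 : 0 < e)
    {k : Fin n → ℕ} (hℓ : HasLen (len e k) s) {θ : ℝ} (hθ : s.real 5 0 = θ) (hθ0 : 0 ≤ θ)
    {B : ℝ} (hB : ∀ w, excess G a w ≤ B) {p : ℕ} (hp : θ * B ≤ (1 + e) ^ p)
    (hk : ∀ v, k v ≤ p) :
    ∃ (k' : Fin n → ℕ) (r : ℕ), (∀ v, k v ≤ k' v) ∧ (∀ v, k' v ≤ p) ∧
      (∀ y, IsValid G y → ∑ v, len e k' v - ∑ v, len e k v ≤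
        e * θ * (potential a y k' - potential a y k)) ∧
      (∀ w, demand G a θ (len e k') w ≤ θ * a w + len e k' w) ∧
      ∑ v, k' v = ∑ v, k v + r ∧
      Run phaseProg s (180 * (edges.length + 1) * (r + n) + 10) (HasLen (len e k')) := by
  -- induction on the room left for pushes plus the number of vertices left to examine
  have key : ∀ (d : ℕ) (k : Fin n → ℕ) (s : Store) (w j : ℕ), n * p - ∑ v, k v + j ≤ d →
      w + j = n → HasInput edges a s → s.real 4 0 = e → HasLen (len e k) s → s.real 5 0 = θ →
      (∀ v, k v ≤ p) → s.nat 4 0 = w →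
      (∀ v : Fin n, (v : ℕ) < w → demand G a θ (len e k) v ≤ θ * a v + len e k v) →
      ∃ (k' : Fin n → ℕ) (r : ℕ), (∀ v, k v ≤ k' v) ∧ (∀ v, k' v ≤ p) ∧
        (∀ y, IsValid G y → ∑ v, len e k' v - ∑ v, len e k v ≤
          e * θ * (potential a y k' - potential a y k)) ∧
        (∀ w, demand G a θ (len e k') w ≤ θ * a w + len e k' w) ∧
        ∑ v, k' v = ∑ v, k v + r ∧
        Run (.loop (.not (.nle (.get 0 (.const 0)) (.var 4))) examineProg) s
          (180 * (edges.length + 1) * (r + j) + 7) (HasLen (len e k')) := by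
    intro d
    induction d with
    | zero =>
      intro k s w j hd hj h he hℓ hθ hk hw hdone
      obtain rfl : j = 0 := by omega
      obtain rfl : w = n := by omega
      refine ⟨k, 0, fun v => le_rfl, hk, by simp, fun v => hdone v v.2, rfl, ?_⟩
      refine (Run.loopDone ?_ hℓ).mono ?_ (fun _ _ h => h)
      · simp [Cond.holds, NExpr.eval, hw, h.size]
      · simp [Cond.cost, NExpr.cost]
    | succ d ih =>
      intro k s w j hd hj h he hℓ hθ hk hw hdone
      rcases Nat.eq_zero_or_pos j with rfl | hjpos
      · obtain rfl : w = n := by omega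
        refine ⟨k, 0, fun v => le_rfl, hk, by simp, fun v => hdone v v.2, rfl, ?_⟩
        refine (Run.loopDone ?_ hℓ).mono ?_ (fun _ _ h => h)
        · simp [Cond.holds, NExpr.eval, hw, h.size]
        · simp [Cond.cost, NExpr.cost]
      have hwn : w < n := by omega
      have hc : (Cond.not (.nle (.get 0 (.const 0)) (.var 4))).holds s := by
        simp [Cond.holds, NExpr.eval, hw, h.size, hwn]
      obtain ⟨t, s1, hx, ht, hs1⟩ := run_examineProg hG hE h he hℓ hθ (w := ⟨w, hwn⟩) hw
      have hF := hx.frame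
      have h1 : HasInput edges a s1 := h.frame hF rfl rfl rfl rfl
      have he1 : s1.real 4 0 = e := by rw [hF.real 4 rfl, he]
      have hθ1 : s1.real 5 0 = θ := by rw [hF.real 5 rfl, hθ]
      rcases hs1 with ⟨hle, hw1, hℓ1⟩ | ⟨hlt, hw1, hℓ1⟩
      · obtain ⟨k', r, hkk, hk', hgain, hd', hr, hrun⟩ := ih k s1 (w + 1) (j - 1) (by omega)
          (by omega) h1 he1 hℓ1 hθ1 hk hw1 (fun v hv => by
            rcases Nat.lt_succ_iff_lt_or_eq.1 hv with hv | hv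
            · exact hdone v hv
            · obtain rfl : v = ⟨w, hwn⟩ := Fin.ext hv
              exact hle)
        refine ⟨k', r, hkk, hk', hgain, hd', hr, ?_⟩
        refine (Run.loopStep hc ⟨t, s1, hx, ht, hrun⟩).mono ?_ (fun _ _ h => h)
        obtain ⟨i, rfl⟩ : ∃ i, j = i + 1 := ⟨j - 1, by omega⟩
        simp only [Cond.cost, NExpr.cost, Nat.add_sub_cancel]
        ring_nf
        omega
      · have hpush := push_le hG ha he0 hθ0 hB hp hk hlt
        have hgt := sum_push_gt (G := G) (a := a) θ e k ⟨w, hwn⟩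
        have hnp : ∑ v, push G a θ e k ⟨w, hwn⟩ v ≤ n * p := by
          refine (sum_le_card_nsmul _ _ p fun v _ => hpush v).trans ?_
          simp
        obtain ⟨k', r, hkk, hk', hgain, hd', hr, hrun⟩ :=
          ih (push G a θ e k ⟨w, hwn⟩) s1 w j (by omega) hj h1 he1 hℓ1 hθ1 hpush hw1
            -- pushes only lengthen, so they do not violate constraints that were satisfied
            (fun v hv => by
              have hmono := len_mono he0.le (le_push (G := G) (a := a) θ e k ⟨w, hwn⟩)
              linarith [hdone v hv, demand_antitone (G := G) (a := a) θ hmono v, hmono v])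
        obtain ⟨i, hi⟩ : ∃ i, ∑ v, push G a θ e k ⟨w, hwn⟩ v = ∑ v, k v + (i + 1) :=
          ⟨∑ v, push G a θ e k ⟨w, hwn⟩ v - ∑ v, k v - 1, by omega⟩
        refine ⟨k', r + (i + 1), fun v => (le_push θ e k _ v).trans (hkk v), hk', fun y hy => ?_,
          hd', by omega, ?_⟩
        · have h2 := sum_len_push_le hG he0 hθ0 hlt hy
          linarith [hgain y hy]
        · refine (Run.loopStep hc ⟨t, s1, hx, ht, hrun⟩).mono ?_ (fun _ _ h => h)
          simp only [Cond.cost, NExpr.cost]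
          have := Nat.zero_le (edges.length * i)
          ring_nf
          ring_nf at this
          omega
  set s0 := s.writeN 4 ((NExpr.const 0).eval s) ((NExpr.const 0).eval s) with hs0
  have hF0 : Frame (.letN 4 (.const 0)) s s0 := Exec.frame (.setN s 4 (.const 0) (.const 0))
  obtain ⟨k', r, hkk, hk', hgain, hd', hr, hrun⟩ := key _ k s0 0 n le_rfl (by omega)
    (h.frame hF0 rfl rfl rfl rfl) he hℓ hθ hk (by simp [hs0, Store.writeN, NExpr.eval]) (by simp)
  refine ⟨k', r, hkk, hk', hgain, hd', hr, ?_⟩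
  refine Run.mono (Run.seq (T := 3) (Run.mono (Run.setN hrun) ?_ (fun _ _ h => h)))
    (by omega) (fun _ _ h => h)
  simp [NExpr.cost]

/-- The state of the computation after `p` rounds, with exponents `k`. -/
structure RoundInv (G : Digraph (Fin n)) [DecidableRel G.Adj] (edges : List (Fin n × Fin n))
    (a : Fin n → ℝ) (e B : ℝ) (q p : ℕ) (k : Fin n → ℕ) (s : Store) : Prop where
  input : HasInput edges a s
  len : HasLen (len e k) s
  precision : s.real 4 0 = e
  scale : s.real 5 0 = (1 + e) ^ p / B
  exponent : s.real 9 0 = q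
  round : s.real 10 0 = p
  phase : PhaseInv G a e B p k (s.real 8 0)
  valid : IsValid G (output n s)
  cost : l1Cost a (output n s) ≤ s.real 8 0

/-- A round preserves the invariant; as for `run_phaseProg`, its time is paid for by the growth `r`
of the sum of all exponents. -/
theorem run_roundProg (hG : ∀ u v w, G.Adj u v → ¬ G.Adj v w) (hE : IsEdgeList G edges)
    (ha : ∀ v, 0 ≤ a v) {e B : ℝ} (he : 0 < e) (hB0 : 0 < B) (hB : ∀ w, excess G a w ≤ B)
    (hc : ∀ y, IsValid G y → 0 < l1Cost a y) {q p : ℕ} {k : Fin n → ℕ} {s : Store}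
    (h : RoundInv G edges a e B q p k s) :
    ∃ (k' : Fin n → ℕ) (r : ℕ), ∑ v, k' v = ∑ v, k v + r ∧
      Run roundProg s (300 * (edges.length + 1) * (r + n + 1)) (RoundInv G edges a e B q (p + 1) k')
      := by
  have hG' : ∀ w, ¬ G.Adj w w := fun w hw => hG w w w hw hw
  have hθ : 0 < (1 + e) ^ (p + 1) / B := by positivity
  set θ := (1 + e) ^ (p + 1) / B with hθdef
  obtain ⟨t1, s1, hx1, ht1, hs1⟩ : Run (.letR 10 (.add (.var 10) (.const 1))) s 6
      (fun s' => s'.real 10 0 = (p + 1 : ℕ)) :=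
    (Run.setR (by simp [Store.writeR, NExpr.eval, RExpr.eval, h.round])).mono
      (by simp [NExpr.cost, RExpr.cost]) (fun _ _ h => h)
  have hF1 := hx1.frame
  obtain ⟨t2, s2, hx2, ht2, hs2⟩ : Run (.letR 5 (.mul (.var 5) (.add (.const 1) (.var 4)))) s1 9
      (fun s' => s'.real 5 0 = θ) := by
    refine (Run.setR ?_).mono (by simp [NExpr.cost, RExpr.cost]) (fun _ _ h => h)
    simp [Store.writeR, NExpr.eval, RExpr.eval, hF1.real 5 rfl, hF1.real 4 rfl, h.scale,
      h.precision, hθdef]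
    ring
  have hF2 := hx2.frame
  have h2 : HasInput edges a s2 :=
    (h.input.frame hF1 rfl rfl rfl rfl).frame hF2 rfl rfl rfl rfl
  have hℓ2 : HasLen (SumSmoothing.len e k) s2 := fun v => by
    rw [hF2.real 3 rfl, hF1.real 3 rfl, h.len v]
  have he2 : s2.real 4 0 = e := by rw [hF2.real 4 rfl, hF1.real 4 rfl, h.precision]
  obtain ⟨k', r, hkk, hk', hgain, hd, hr, hrun⟩ := run_phaseProg hG' hE ha h2 he2 he hℓ2 hs2
    hθ.le hB (p := p + 1) (by rw [hθdef, div_mul_cancel₀ _ hB0.ne'])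
    (fun v => (h.phase.k_le v).trans (Nat.le_succ p))
  obtain ⟨t3, s3, hx3, ht3, hs3⟩ := hrun
  have hF3 := hx3.frame
  have h3 : HasInput edges a s3 := h2.frame hF3 rfl rfl rfl rfl
  obtain ⟨t4, s4, hx4, ht4, hs4⟩ := run_sumLenProg h3 hs3
  have hF4 := hx4.frame
  have h4 : HasInput edges a s4 := h3.frame hF4 rfl rfl rfl rfl
  have hℓ4 : HasLen (SumSmoothing.len e k') s4 := fun v => by rw [hF4.real 3 rfl, hs3 v]
  have h54 : s4.real 5 0 = θ := by rw [hF4.real 5 rfl, hF3.real 5 rfl, hs2]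
  have he4 : s4.real 4 0 = e := by rw [hF4.real 4 rfl, hF3.real 4 rfl, he2]
  have h8 : s4.real 8 = s.real 8 := by
    rw [hF4.real 8 rfl, hF3.real 8 rfl, hF2.real 8 rfl, hF1.real 8 rfl]
  have h9 : s4.real 9 0 = q := by
    rw [hF4.real 9 rfl, hF3.real 9 rfl, hF2.real 9 rfl, hF1.real 9 rfl, h.exponent]
  have h10 : s4.real 10 0 = (p + 1 : ℕ) := by
    rw [hF4.real 10 rfl, hF3.real 10 rfl, hF2.real 10 rfl, hs1]
  have hout : output n s4 = output n s := by
    unfold output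
    rw [hF4.real 2 rfl, hF3.real 2 rfl, hF2.real 2 rfl, hF1.real 2 rfl]
  have hpos : ∀ v, 0 ≤ SumSmoothing.len e k' v := fun v => (len_pos he.le k' v).le
  have hlast : Run (.ite (.rle (.mul (.var 8) (.var 5)) (.var 12)) .skip recordProg) s4
      (70 * (n + edges.length + 1)) (RoundInv G edges a e B q (p + 1) k') := by
    refine (Run.ite (T := 60 * (n + edges.length + 1)) (fun hc' => ?_) (fun hc' => ?_)).mono ?_
      (fun _ _ h => h)
    · simp only [Cond.holds, RExpr.eval, NExpr.eval, h54, hs4] at hc'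
      refine (Run.skip ⟨h4, hℓ4, he4, h54, h9, h10, ?_, ?_, ?_⟩).mono (by omega) (fun _ _ h => h)
      · exact h.phase.step he hB0 hc hk' (by rw [h8]) hc' hgain hkk
      · rw [hout]; exact h.valid
      · rw [hout, h8]; exact h.cost
    · simp only [Cond.holds, RExpr.eval, NExpr.eval, h54, hs4, not_le] at hc'
      refine (run_recordProg hE h4 hℓ4).mono le_rfl fun s5 hF5 hs5 => ?_
      have h85 : s5.real 8 0 = (∑ v, SumSmoothing.len e k' v) / θ := by rw [hs5.1, hs4, h54]
      have hout5 := hs5.2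
      rw [h54] at hout5
      refine ⟨h4.frame hF5 rfl rfl rfl rfl, fun v => ?_, ?_, ?_, ?_, ?_, ?_, ?_, ?_⟩
      · rw [hF5.real 3 rfl, hℓ4 v]
      · rw [hF5.real 4 rfl, he4]
      · rw [hF5.real 5 rfl, h54]
      · rw [hF5.real 9 rfl, h9]
      · rw [hF5.real 10 rfl, h10]
      · refine h.phase.step he hB0 hc hk' ?_ ?_ hgain hkk
        · rw [h85, div_le_iff₀ hθ, ← h8]; exact hc'.le
        · rw [h85, div_mul_cancel₀ _ hθ.ne']
      · rw [hout5]; exact isValid_roundLen hG ha hθ hpos hd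
      · rw [hout5, h85]; exact l1Cost_roundLen_le ha hθ hpos
    · simp [Cond.cost, NExpr.cost, RExpr.cost]; omega
  refine ⟨k', r, hr, ?_⟩
  refine Run.mono (Run.seq ⟨t1, s1, hx1, ht1, Run.seq ⟨t2, s2, hx2, ht2,
    Run.seq ⟨t3, s3, hx3, ht3, Run.seq ⟨t4, s4, hx4, ht4, hlast⟩⟩⟩⟩) ?_ (fun _ _ h => h)
  generalize edges.length = m
  have h1 := Nat.zero_le (m * n)
  have h2 := Nat.zero_le (m * r)
  ring_nf
  ring_nf at h1 h2
  omega

/-- All rounds together: the pushes telescope, because after `P` rounds the sum of all exponents is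
at most `n * P`. -/
theorem run_roundsProg (hG : ∀ u v w, G.Adj u v → ¬ G.Adj v w) (hE : IsEdgeList G edges)
    (ha : ∀ v, 0 ≤ a v) {e B : ℝ} (he : 0 < e) (hB0 : 0 < B) (hB : ∀ w, excess G a w ≤ B)
    (hc : ∀ y, IsValid G y → 0 < l1Cost a y) {q P : ℕ} (hP : (q : ℝ) ≤ P * e) {s : Store}
    {k : Fin n → ℕ} (h : RoundInv G edges a e B q 0 k s) :
    Run roundsProg s (320 * (edges.length + 1) * (n * P + P * (n + 1)) + 10)
      (fun s' => ∃ (p : ℕ) (k' : Fin n → ℕ),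
          (q : ℝ) ≤ p * e ∧ RoundInv G edges a e B q p k' s') := by
  have key : ∀ (j p N : ℕ) (k : Fin n → ℕ) (s : Store), p + j = P → ∑ v, k v + N = n * P →
      RoundInv G edges a e B q p k s →
      Run roundsProg s (320 * (edges.length + 1) * (N + j * (n + 1)) + 10)
        (fun s' => ∃ (p : ℕ) (k' : Fin n → ℕ),
          (q : ℝ) ≤ p * e ∧ RoundInv G edges a e B q p k' s') := by
    intro j
    induction j with
    | zero =>
      intro p N k s hp hN h
      obtain rfl : p = P := by omega
      refine (Run.loopDone ?_ ⟨p, k, hP, h⟩).mono ?_ (fun _ _ h => h)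
      · simp [Cond.holds, RExpr.eval, NExpr.eval, h.exponent, h.round, h.precision, hP]
      · simp [Cond.cost, NExpr.cost, RExpr.cost]
    | succ j ih =>
      intro p N k s hp hN h
      by_cases hq : (q : ℝ) ≤ p * e
      · refine (Run.loopDone ?_ ⟨p, k, hq, h⟩).mono ?_ (fun _ _ h => h)
        · simp [Cond.holds, RExpr.eval, NExpr.eval, h.exponent, h.round, h.precision, hq]
        · simp [Cond.cost, NExpr.cost, RExpr.cost]
      · obtain ⟨k', r, hr, t1, s1, hx1, ht1, hs1⟩ := run_roundProg hG hE ha he hB0 hB hc h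
        have hsum : ∑ v, k' v ≤ n * P := by
          refine (sum_le_card_nsmul _ _ P fun v _ => (hs1.phase.k_le v).trans ?_).trans ?_
          · omega
          · simp
        have hrun := ih (p + 1) (N - r) k' s1 (by omega) (by omega) hs1
        obtain ⟨N', rfl⟩ : ∃ N', N = N' + r := ⟨N - r, by omega⟩
        refine (Run.loopStep ?_ ⟨t1, s1, hx1, ht1, hrun⟩).mono ?_ (fun _ _ h => h)
        · simpa [Cond.holds, RExpr.eval, NExpr.eval, h.exponent, h.round, h.precision] using hq
        · simp only [Cond.cost, NExpr.cost, RExpr.cost, Nat.add_sub_cancel]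
          generalize edges.length = m
          have h1 := Nat.zero_le (m * n)
          have h2 := Nat.zero_le (m * r)
          ring_nf
          ring_nf at h1 h2
          omega
  have hk0 : ∑ v, k v = 0 := sum_eq_zero fun v _ => Nat.le_zero.1 (h.phase.k_le v)
  exact key P 0 (n * P) k s (by omega) (by omega) h

theorem run_exponentProg {s : Store} {e : ℝ} (he : s.real 4 0 = e) {q : ℕ}
    (hn : s.real 12 0 = n) (hq : (n : ℝ) ≤ (1 + e) ^ q) (hq' : ∀ j < q, (1 + e) ^ j < (n : ℝ)) :
    Run exponentProg s (30 * (q + 1)) (fun s' => s'.real 9 0 = q) := by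
  have key : ∀ (j i : ℕ) (s : Store), i + j = q → s.real 4 0 = e → s.real 12 0 = n →
      s.real 11 0 = (1 + e) ^ i → s.real 9 0 = i →
      Run (.loop (.not (.rle (.var 12) (.var 11)))
        (.seq (.letR 11 (.mul (.var 11) (.add (.const 1) (.var 4))))
          (.letR 9 (.add (.var 9) (.const 1))))) s (30 * j + 7) (fun s' => s'.real 9 0 = q) := by
    intro j
    induction j with
    | zero =>
      intro i s hi he hn h11 h9
      obtain rfl : i = q := by omega
      refine (Run.loopDone ?_ h9).mono ?_ (fun _ _ h => h)
      · simp [Cond.holds, RExpr.eval, NExpr.eval, hn, h11, hq]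
      · simp [Cond.cost, NExpr.cost, RExpr.cost]
    | succ j ih =>
      intro i s hi he hn h11 h9
      refine (Run.loopStep (T := 9 + 6) ?_ (Run.seq ((Run.setR ((Run.setR
        (ih (i + 1) _ (by omega) ?_ ?_ ?_ ?_)).mono (T' := 6) ?_ (fun _ _ h => h))).mono ?_
          (fun _ _ h => h)))).mono ?_ (fun _ _ h => h)
      · simpa [Cond.holds, RExpr.eval, NExpr.eval, hn, h11] using hq' i (by omega)
      · simpa [Store.writeR] using he
      · simpa [Store.writeR] using hn
      · simp [Store.writeR, RExpr.eval, NExpr.eval, h11, he, pow_succ]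
      · simp [Store.writeR, RExpr.eval, NExpr.eval, h9]
      · simp [NExpr.cost, RExpr.cost]
      · simp [NExpr.cost, RExpr.cost]
      · simp [Cond.cost, NExpr.cost, RExpr.cost]; omega
  refine Run.mono (Run.seq (T := 3) ((Run.setR (Run.seq (T := 3) ((Run.setR
    (key q 0 _ (by omega) ?_ ?_ ?_ ?_)).mono ?_ (fun _ _ h => h)))).mono ?_ (fun _ _ h => h)))
      (by omega) (fun _ _ h => h)
  · simpa [Store.writeR] using he
  · simpa [Store.writeR] using hn
  · simp [Store.writeR, RExpr.eval, NExpr.eval]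
  · simp [Store.writeR, RExpr.eval, NExpr.eval]
  · simp [NExpr.cost, RExpr.cost]
  · simp [NExpr.cost, RExpr.cost]

theorem run_approxProg (hG : ∀ u v w, G.Adj u v → ¬ G.Adj v w) (hE : IsEdgeList G edges)
    (ha : ∀ v, 0 ≤ a v) {s : Store} (h : HasInput edges a s) {e : ℝ} (he : s.real 4 0 = e)
    (he0 : 0 < e) (he1 : e ≤ 1 / 8) (hB0 : 0 < s.real 6 0)
    (hB : ∀ w, excess G a w ≤ s.real 6 0) (hB' : ∃ w, s.real 6 0 = excess G a w) {q P : ℕ}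
    (hq : (n : ℝ) ≤ (1 + e) ^ q) (hq' : ∀ j < q, (1 + e) ^ j < (n : ℝ))
    (hP : (q : ℝ) ≤ P * e) :
    Run approxProg s (900 * (n + 1) * (edges.length + 1) * (P + q + 1)) (fun s' =>
      IsValid G (output n s') ∧ ∀ y, IsValid G y →
        l1Cost a (output n s') ≤ (1 + 8 * e) * l1Cost a y) := by
  have hG' : ∀ w, ¬ G.Adj w w := fun w hw => hG w w w hw hw
  set B := s.real 6 0 with hBdef
  have hBc : ∀ y, IsValid G y → B ≤ l1Cost a y := fun y hy => by
    obtain ⟨w, hw⟩ := hB'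
    rw [hw]; exact excess_le_l1Cost hG' hy w
  obtain ⟨t1, s1, hx1, ht1, hℓ1, hs1⟩ := run_initLenProg h
  have hF1 := hx1.frame
  have h1 : HasInput edges a s1 := h.frame hF1 rfl rfl rfl rfl
  obtain ⟨t2, s2, hx2, ht2, hs2⟩ :=
    run_exponentProg (s := s1) (by rw [hF1.real 4 rfl, he]) hs1 hq hq'
  have hF2 := hx2.frame
  have h2 : HasInput edges a s2 := h1.frame hF2 rfl rfl rfl rfl
  obtain ⟨t3, s3, hx3, ht3, hs3⟩ : Run (.letR 10 (.const 0)) s2 3 (fun s' => s'.real 10 0 = 0) :=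
    (Run.setR (by simp [Store.writeR, NExpr.eval, RExpr.eval])).mono
      (by simp [NExpr.cost, RExpr.cost]) (fun _ _ h => h)
  have hF3 := hx3.frame
  have h3 : HasInput edges a s3 := h2.frame hF3 rfl rfl rfl rfl
  obtain ⟨t4, s4, hx4, ht4, hs4⟩ : Run (.letR 5 (.div (.const 1) (.var 6))) s3 6
      (fun s' => s'.real 5 0 = 1 / B) := by
    refine (Run.setR ?_).mono (by simp [NExpr.cost, RExpr.cost]) (fun _ _ h => h)
    simp [Store.writeR, NExpr.eval, RExpr.eval, hF3.real 6 rfl, hF2.real 6 rfl, hF1.real 6 rfl,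
      hBdef]
  have hF4 := hx4.frame
  have h4 : HasInput edges a s4 := h3.frame hF4 rfl rfl rfl rfl
  have hone : (fun _ : Fin n => (1 : ℝ)) = len e (fun _ => 0) := by ext; simp [len]
  rw [hone] at hℓ1
  have hℓ4 : HasLen (len e (fun _ : Fin n => 0)) s4 := fun v => by
    rw [hF4.real 3 rfl, hF3.real 3 rfl, hF2.real 3 rfl, hℓ1 v]
  have h12 : s4.real 12 0 = n := by
    rw [hF4.real 12 rfl, hF3.real 12 rfl, hF2.real 12 rfl, hs1]
  obtain ⟨t5, s5, hx5, ht5, h85, hs5⟩ := run_recordProg hE h4 hℓ4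
  have hF5 := hx5.frame
  rw [hs4] at h85 hs5
  have hpos : ∀ v : Fin n, 0 ≤ len e (fun _ => 0) v := fun v => (len_pos he0.le _ v).le
  have hθ : 0 < 1 / B := by positivity
  have h85' : s5.real 8 0 = Fintype.card (Fin n) * B := by simp [h85, h12]
  have hinv : RoundInv G edges a e B q 0 (fun _ => 0) s5 := by
    refine ⟨h4.frame hF5 rfl rfl rfl rfl, fun v => ?_, ?_, ?_, ?_, ?_, ?_, ?_, ?_⟩
    · rw [hF5.real 3 rfl, hℓ4 v]
    · rw [hF5.real 4 rfl, hF4.real 4 rfl, hF3.real 4 rfl, hF2.real 4 rfl, hF1.real 4 rfl, he]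
    · rw [hF5.real 5 rfl, hs4, pow_zero]
    · rw [hF5.real 9 rfl, hF4.real 9 rfl, hF3.real 9 rfl, hs2]
    · rw [hF5.real 10 rfl, hF4.real 10 rfl, hs3, Nat.cast_zero]
    · rw [h85']; exact PhaseInv.init
    · rw [hs5]
      refine isValid_roundLen hG ha hθ hpos fun w => ?_
      -- a push at scale `1 / B` would keep all exponents at `0`
      by_contra! hlt
      have := push_le hG' ha he0 hθ.le hB (p := 0) (by simp [hB0.ne']) (fun _ => le_rfl) hlt w
      simp [push] at this
    · rw [hs5, h85, h12]
      refine (l1Cost_roundLen_le ha hθ hpos).trans (le_of_eq ?_)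
      simp [len]
  have hrun := run_roundsProg hG hE ha he0 hB0 hB (fun y hy => hB0.trans_le (hBc y hy)) hP hinv
  refine Run.mono (Run.seq ⟨t1, s1, hx1, ht1, Run.seq ⟨t2, s2, hx2, ht2, Run.seq ⟨t3, s3, hx3,
    ht3, Run.seq ⟨t4, s4, hx4, ht4, Run.seq ⟨t5, s5, hx5, ht5, hrun⟩⟩⟩⟩⟩) ?_ ?_
  · generalize edges.length = m
    have h1 := Nat.zero_le (m * n)
    have h2 := Nat.zero_le (m * n * P)
    have h3 := Nat.zero_le (m * n * q)
    have h4 := Nat.zero_le (m * P)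
    have h5 := Nat.zero_le (m * q)
    have h6 := Nat.zero_le (n * P)
    have h7 := Nat.zero_le (n * q)
    ring_nf
    ring_nf at h1 h2 h3 h4 h5 h6 h7
    omega
  · rintro s' - ⟨p, k, hp, hinv⟩
    exact ⟨hinv.valid, fun y hy => hinv.cost.trans
      (hinv.phase.best_le_mul he0 he1 hB0 (by simpa using hq) hp hy (hBc y hy))⟩

/-- The bounds `q` and `P` on the numbers of iterations enter only the time; `exists_rounds_bound`
provides them. -/
theorem run_smoothProg (hG : ∀ u v w, G.Adj u v → ¬ G.Adj v w) (hE : IsEdgeList G edges)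
    (ha : ∀ v, 0 ≤ a v) {ε : ℝ} (hε : 0 < ε) {q P : ℕ}
    (hq : (n : ℝ) ≤ (1 + min ε 1 / 8) ^ q) (hq' : ∀ j < q, (1 + min ε 1 / 8) ^ j < (n : ℝ))
    (hP : (q : ℝ) ≤ P * (min ε 1 / 8)) :
    Run smoothProg (inputStore edges a ε) (1100 * (n + 1) * (edges.length + 1) * (P + q + 1))
      (fun s' => IsValid G (output n s') ∧ ∀ y, IsValid G y →
        l1Cost a (output n s') ≤ (1 + min ε 1) * l1Cost a y) := by
  have hG' : ∀ w, ¬ G.Adj w w := fun w hw => hG w w w hw hw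
  set s := inputStore edges a ε
  have h : HasInput edges a s := hasInput_inputStore ε
  have h0 : s.real 0 0 = ε := rfl
  have hmin : 0 < min ε 1 := lt_min hε one_pos
  obtain ⟨t1, s1, hx1, ht1, hs1⟩ : Run precisionProg s 11
      (fun s' => s'.real 4 0 = min ε 1 / 8) := by
    refine (Run.ite (T := 6) (fun hc => ?_) (fun hc => ?_)).mono ?_ (fun _ _ h => h)
    · simp only [Cond.holds, RExpr.eval, NExpr.eval, h0, Nat.cast_one] at hc
      refine (Run.setR ?_).mono (by simp [NExpr.cost, RExpr.cost]) (fun _ _ h => h)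
      simp [Store.writeR, NExpr.eval, RExpr.eval, min_eq_right hc]
    · simp only [Cond.holds, RExpr.eval, NExpr.eval, h0, Nat.cast_one, not_le] at hc
      refine (Run.setR ?_).mono (by simp [NExpr.cost, RExpr.cost]) (fun _ _ h => h)
      simp [Store.writeR, NExpr.eval, RExpr.eval, h0, min_eq_left hc.le]
    · simp [Cond.cost, NExpr.cost, RExpr.cost]
  have hF1 := hx1.frame
  have h1 : HasInput edges a s1 := h.frame hF1 rfl rfl rfl rfl
  obtain ⟨t2, s2, hx2, ht2, hB, hB'⟩ := run_maxExcessProg ha hE h1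
    (fun v => by rw [hF1.real 3 rfl]; rfl) (by rw [hF1.real 6 rfl]; rfl)
  have hF2 := hx2.frame
  have h2 : HasInput edges a s2 := h1.frame hF2 rfl rfl rfl rfl
  have hlast : Run (.ite (.rle (.var 6) (.const 0))
      (forVerts (.setR 2 (.var 4) (.get 1 (.var 4)))) approxProg) s2
      (920 * (n + 1) * (edges.length + 1) * (P + q + 1)) (fun s' =>
        IsValid G (output n s') ∧ ∀ y, IsValid G y →
          l1Cost a (output n s') ≤ (1 + min ε 1) * l1Cost a y) := by
    have hpos : 0 < (n + 1) * (edges.length + 1) * (P + q + 1) := by positivity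
    refine (Run.ite (T := 900 * (n + 1) * (edges.length + 1) * (P + q + 1)) (fun hc => ?_)
      (fun hc => ?_)).mono ?_ (fun _ _ h => h)
    · simp only [Cond.holds, RExpr.eval, NExpr.eval, Nat.cast_zero] at hc
      have := Run.forRange (v := 4) (b := 0) (s := s2) (c := 10)
        (body := .setR 2 (.var 4) (.get 1 (.var 4)))
        (fun i s' => ∀ v : Fin n, (v : ℕ) < i → s'.real 2 v = a v) (by norm_num) rfl rfl
        (fun i s' x h => h) (by simp) ?_
      · rw [h2.size] at this
        refine this.mono ?_ fun s' _ hs' => ?_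
        · generalize edges.length = m at hpos ⊢
          have h1 := Nat.zero_le (m * n)
          have h2 := Nat.zero_le (m * n * P)
          have h3 := Nat.zero_le (m * n * q)
          have h6 := Nat.zero_le (n * P)
          have h7 := Nat.zero_le (n * q)
          have h4 := Nat.zero_le (m * P)
          have h5 := Nat.zero_le (m * q)
          ring_nf
          ring_nf at h1 h2 h3 h4 h5 h6 h7
          omega
        · have hout : output n s' = a := funext fun v => hs' v v.2
          rw [hout]
          refine ⟨isValid_of_excess_nonpos ha fun w => (hB w).trans hc, fun y _ => ?_⟩
          have h0 : l1Cost a a = 0 := by simp [l1Cost]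
          rw [h0]
          exact mul_nonneg (by linarith) (sum_nonneg fun _ _ => abs_nonneg _)
      intro i s' hi hF hvi hI
      rw [h2.size] at hi
      have h' : HasInput edges a s' := h2.frame hF rfl rfl rfl rfl
      refine (Run.setR fun v hv => ?_).mono (by simp [NExpr.cost, RExpr.cost]) (fun _ _ h => h)
      rcases Nat.lt_succ_iff_lt_or_eq.1 hv with hv | hv
      · simp [Store.writeR, NExpr.eval, hvi, hv.ne, hI v hv]
      · obtain rfl : v = ⟨i, hi⟩ := Fin.ext hv
        have hai : s'.real 1 i = a ⟨i, hi⟩ := h'.target ⟨i, hi⟩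
        simp [Store.writeR, NExpr.eval, RExpr.eval, hvi, hai]
    · simp only [Cond.holds, RExpr.eval, NExpr.eval, Nat.cast_zero, not_le] at hc
      refine (run_approxProg hG hE ha h2 (e := min ε 1 / 8) (by rw [hF2.real 4 rfl, hs1])
        (by positivity) (by linarith [min_le_right ε 1]) hc hB (hB' hc) hq hq' hP).mono le_rfl
        fun s' _ hs' => ?_
      rwa [mul_div_cancel₀ _ (by norm_num : (8 : ℝ) ≠ 0)] at hs'
    · simp only [Cond.cost, NExpr.cost, RExpr.cost]
      linarith
  refine Run.mono (Run.seq ⟨t1, s1, hx1, ht1, Run.seq ⟨t2, s2, hx2, ht2, hlast⟩⟩) ?_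
    (fun _ _ h => h)
  generalize edges.length = m
  have h1 := Nat.zero_le (m * n)
  have h2 := Nat.zero_le (m * n * P)
  have h3 := Nat.zero_le (m * n * q)
  have h6 := Nat.zero_le (n * P)
  have h7 := Nat.zero_le (n * q)
  have h4 := Nat.zero_le (m * P)
  have h5 := Nat.zero_le (m * q)
  ring_nf
  ring_nf at h1 h2 h3 h4 h5 h6 h7
  omega

/-- The number of rounds is `O(log n / e ^ 2)`. -/
theorem exists_rounds_bound {e : ℝ} (he : 0 < e) (he' : e ≤ 1 / 8) (n : ℕ) :
    ∃ q P : ℕ, (n : ℝ) ≤ (1 + e) ^ q ∧ (∀ j < q, (1 + e) ^ j < (n : ℝ)) ∧ (q : ℝ) ≤ P * e ∧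
      (2 ≤ n → (P + q + 1 : ℝ) ≤ 6 * Real.log n / e ^ 2) := by
  classical
  have hex : ∃ q : ℕ, (n : ℝ) ≤ (1 + e) ^ q :=
    (pow_unbounded_of_one_lt (n : ℝ) (by linarith : 1 < 1 + e)).imp fun _ h => h.le
  refine ⟨Nat.find hex, ⌈(Nat.find hex : ℝ) / e⌉₊, Nat.find_spec hex,
    fun j hj => not_le.1 (Nat.find_min hex hj), ?_, fun hn => ?_⟩
  · rw [← div_le_iff₀ he]; exact Nat.le_ceil _
  set q := Nat.find hex
  have hlog : 1 / 2 ≤ Real.log n := by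
    have h1 := Real.log_le_log (by norm_num) (show (2 : ℝ) ≤ n by exact_mod_cast hn)
    linarith [Real.log_two_gt_d9]
  have hl2 : e / 2 ≤ Real.log (1 + e) := by
    refine le_trans ?_ (Real.one_sub_inv_le_log_of_pos (show 0 < 1 + e by linarith))
    have h6 : 1 - (1 + e)⁻¹ = e / (1 + e) := by field_simp; ring
    rw [h6]
    gcongr
    linarith
  have hq : (q : ℝ) ≤ 1 + 2 * Real.log n / e := by
    have h0 : 0 ≤ 2 * Real.log n / e := by positivity
    rcases Nat.eq_zero_or_pos q with hq0 | hq0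
    · rw [hq0, Nat.cast_zero]; linarith
    · have h1 : (1 + e) ^ (q - 1) < (n : ℝ) := not_le.1 (Nat.find_min hex (by omega))
      have h2 := Real.log_lt_log (by positivity) h1
      rw [Real.log_pow, Nat.cast_sub hq0, Nat.cast_one] at h2
      have h3 : (0 : ℝ) ≤ q - 1 := by
        rw [sub_nonneg]; exact_mod_cast hq0
      have h4 : (q - 1 : ℝ) ≤ 2 * Real.log n / e := by
        rw [le_div_iff₀ he]
        nlinarith [mul_le_mul_of_nonneg_left hl2 h3]
      linarith
  have hc := (Nat.ceil_lt_add_one (show 0 ≤ (q : ℝ) / e by positivity)).le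
  rw [le_div_iff₀ (by positivity)]
  have h1 : (⌈(q : ℝ) / e⌉₊ : ℝ) * e ≤ q + e := by
    calc _ ≤ ((q : ℝ) / e + 1) * e := by gcongr
      _ = q + e := by field_simp
  have h2 : (q : ℝ) * e ≤ e + 2 * Real.log n := by
    calc (q : ℝ) * e ≤ (1 + 2 * Real.log n / e) * e := by gcongr
      _ = _ := by field_simp
  have h3 : (⌈(q : ℝ) / e⌉₊ : ℝ) * e * e ≤ (q + e) * e := by gcongr
  have h4 : (q : ℝ) * e * e ≤ (e + 2 * Real.log n) * e := by gcongr
  nlinarith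

end Rounds

end SumSmoothing

theorem mainTheorem7 :
    ∃ (P : RealRAM.Prog) (C : ℝ),
      ∀ (n : ℕ) (G : Digraph (Fin n)) [DecidableRel G.Adj] (edges : List (Fin n × Fin n))
        (a : Fin n → ℝ) (ε : ℝ),
        SumSmoothing.IsBilayered G → SumSmoothing.IsEdgeList G edges →
        (∀ v, 0 ≤ a v) → 0 < ε →
        ∃ (t : ℕ) (s : RealRAM.Store),
          RealRAM.Exec P (SumSmoothing.inputStore edges a ε) t s ∧
          SumSmoothing.IsValid G (SumSmoothing.output n s) ∧
          (∀ y : Fin n → ℝ, SumSmoothing.IsValid G y →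
            SumSmoothing.l1Cost a (SumSmoothing.output n s) ≤
              (1 + ε) * SumSmoothing.l1Cost a y) ∧
          (edges ≠ [] →
            (t : ℝ) ≤ C * ((n : ℝ) * (edges.length : ℝ) * Real.log n / (min ε 1) ^ 2)) := by
  refine ⟨SumSmoothing.smoothProg, 1100 * 4 * (6 * 64), fun n G _ edges a ε hbi hE ha hε => ?_⟩
  have hG : ∀ u v w, G.Adj u v → ¬ G.Adj v w := by
    obtain ⟨U, W, -, hd, hUW⟩ := hbi
    exact fun u v w h1 h2 => Set.disjoint_left.1 hd (hUW v w h2).1 (hUW u v h1).2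
  have hmin : 0 < min ε 1 := lt_min hε one_pos
  obtain ⟨q, P, hq, hq', hP, hbound⟩ := SumSmoothing.exists_rounds_bound (e := min ε 1 / 8)
    (by positivity) (by linarith [min_le_right ε 1]) n
  -- the factor `4 * 6 * 64` absorbs `n + 1 ≤ 2 n`, `|E| + 1 ≤ 2 |E|` and the number of rounds
  obtain ⟨t, s, hx, ht, hvalid, hcost⟩ := SumSmoothing.run_smoothProg hG hE ha hε hq hq' hP
  refine ⟨t, s, hx, hvalid, fun y hy => (hcost y hy).trans ?_, fun hne => ?_⟩
  · exact mul_le_mul_of_nonneg_right (by linarith [min_le_left ε 1])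
      (Finset.sum_nonneg fun _ _ => abs_nonneg _)
  · obtain ⟨⟨u, w⟩, hx⟩ := List.exists_mem_of_ne_nil _ hne
    have hadj := (hE.2 u w).1 hx
    have huw : (u : ℕ) ≠ w := fun h => by
      obtain rfl := Fin.ext h
      exact hG u u u hadj hadj
    have hn : 2 ≤ n := by omega
    have hm : 1 ≤ edges.length := List.length_pos_iff.2 hne
    have hmR : (1 : ℝ) ≤ edges.length := by exact_mod_cast hm
    have hnR : (2 : ℝ) ≤ n := by exact_mod_cast hn
    have ht' : (t : ℝ) ≤ 1100 * (n + 1) * (edges.length + 1) * (P + q + 1) := by exact_mod_cast ht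
    calc (t : ℝ) ≤ 1100 * (n + 1) * (edges.length + 1) * (P + q + 1) := ht'
      _ ≤ 1100 * (2 * n) * (2 * edges.length) * (6 * Real.log n / (min ε 1 / 8) ^ 2) := by
        have := hbound hn
        gcongr <;> linarith
      _ = _ := by field_simp; ring
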